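/- Let $n\in\mathbb N$ and $\hbar>0$. Write points of phase space as $z=(x,p)\in\mathbb R^n\times\mathbb R^n=\mathbb R^{2n}$ with the Euclidean norm, let $B^{2n}(z_0,\sqrt\hbar)$ be the closed ball of centre $z_0$ and radius $\sqrt\hbar$, $B^{2n}(\sqrt\hbar)=B^{2n}(0,\sqrt\hbar)$, and $T(z_0)z=z+z_0$. Let $\operatorname{Sp}(n)$ be the group of real symplectic $2n\times 2n$ matrices and $\operatorname{ISp}(n)$ the group of all maps $S\,T(z_0)$, $S\in\operatorname{Sp}(n)$, $z_0\in\mathbb R^{2n}$. Let $\operatorname{QB}(n)$ be the set of quantum blobs $S(B^{2n}(z_0,\sqrt\hbar))$ ($S\in\operatorname{Sp}(n)$, $z_0\in\mathbb R^{2n}$) and $\operatorname{QB}_0(n)$ the set of centered ones, $S(B^{2n}(\sqrt\hbar))$. On $L^2(\mathbb R^n)$ let $$\widehat T(x_0,p_0)\psi(x)=e^{\frac i\hbar(p_0\cdot x-\frac12p_0\cdot x_0)}\psi(x-x_0).$$ Let $\operatorname{Mp}(n)$ be the group of unitary operators generated by $$\widehat J\psi(x)=\left(\tfrac1{2\pi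 i\hbar}\right)^{n/2}\!\int e^{-\frac i\hbar x\cdot x'}\psi(x')\,d^nx',\qquad \widehat V_P\psi(x)=e^{-\frac i{2\hbar}Px\cdot x}\psi(x),\qquad \widehat M_{L,m}\psi(x)=i^m\sqrt{|\det L|}\,\psi(Lx),$$ where $P$ is real symmetric, $L$ is real invertible, and $m\in\mathbb Z$ is such that $m\pi$ is an argument of $\det L$ (the first formula is extended to $L^2$ by continuity). Let $\operatorname{IMp}(n)$ be the group of unitary operators generated by $\operatorname{Mp}(n)$ and the $\widehat T(z_0)$, $z_0\in\mathbb R^{2n}$. For real symmetric $n\times n$ matrices $A,B$ with $A$ positive definite put $$\psi_{AB}(x)=e^{i\gamma}\left(\tfrac1{\pi\hbar}\right)^{n/4}(\det A)^{1/4}e^{-\frac1{2\hbar}(A+iB)x\cdot x}\quad(\gamma\in\mathbb R\text{ arbitrary}),\qquad S_{AB}=\begin{pmatrix}A^{-1/2}&0\\-BA^{-1/2}&A^{1/2}\end{pmatrix},\qquad G_{AB}=(S_{AB}S_{AB}^T)^{-1}.$$ Let $\operatorname{Gauss}(n)$ be the set of all Gaussian wavepackets $\widehat T(z_0)\psi_{AB}$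 and $\operatorname{Gauss}_0(n)$ the set of the centered ones $\psi_{AB}$; wavepackets that differ only by a constant phase factor are identified. The Wigner transform of $\psi\in L^2(\mathbb R^n)$ is $$W\psi(x,p)=\left(\tfrac1{2\pi\hbar}\right)^n\int e^{-\frac i\hbar p\cdot y}\,\psi(x+\tfrac12y)\,\overline{\psi(x-\tfrac12y)}\,d^ny .$$ (i) Each $S_{AB}$ is symplectic, and $$\widehat T(z_0)\psi_{AB}\longmapsto T(z_0)S_{AB}(B^{2n}(\sqrt\hbar))$$ is a well-defined bijection $\Phi:\operatorname{Gauss}(n)\to\operatorname{QB}(n)$, which maps $\operatorname{Gauss}_0(n)$ onto $\operatorname{QB}_0(n)$. It is obtained through the Wigner transform: a function $\psi\in L^2(\mathbb R^n)$ represents the state $\widehat T(z_0)\psi_{AB}$ if and only if $$W\psi(z)=(\pi\hbar)^{-n}e^{-\frac1\hbar G_{AB}(z-z_0)\cdot(z-z_0)}\quad\text{for all }z,$$ and the corresponding quantum blob is the ellipsoid $\{z: G_{AB}(z-z_0)\cdot(z-z_0)\le\hbar\}$. (ii) There are surjective group homomorphisms $\pi:\operatorname{Mp}(n)\to\operatorname{Sp}(n)$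 and $\pi':\operatorname{IMp}(n)\to\operatorname{ISp}(n)$ (the natural projections) with $$\pi(\widehat J)=\begin{pmatrix}0&I\\-I&0\end{pmatrix},\quad \pi(\widehat V_P)=\begin{pmatrix}I&0\\-P&I\end{pmatrix},\quad \pi(\widehat M_{L,m})=\begin{pmatrix}L^{-1}&0\\0&L^T\end{pmatrix},\quad \pi'(\widehat S\,\widehat T(z_0))=\pi(\widehat S)\,T(z_0)$$ for $\widehat S\in\operatorname{Mp}(n)$, $z_0\in\mathbb R^{2n}$. The group $\operatorname{Sp}(n)$ acts transitively on $\operatorname{QB}_0(n)$, and this induces a transitive action of $\operatorname{Mp}(n)$ on $\operatorname{Gauss}_0(n)$: every $\widehat S\in\operatorname{Mp}(n)$ maps $\operatorname{Gauss}_0(n)$ into itself, $\Phi(\widehat S\psi)=\pi(\widehat S)(\Phi(\psi))$ for $\psi\in\operatorname{Gauss}_0(n)$, and the action is transitive. Likewise $\operatorname{ISp}(n)$ acts transitively on $\operatorname{QB}(n)$, and this induces a transitive action of $\operatorname{IMp}(n)$ on $\operatorname{Gauss}(n)$: every $U\in\operatorname{IMp}(n)$ maps $\operatorname{Gauss}(n)$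 into itself, $\Phi(U\psi)=\pi'(U)(\Phi(\psi))$ for $\psi\in\operatorname{Gauss}(n)$, and for any $\psi,\psi'\in\operatorname{Gauss}(n)$ there are $\widehat S\in\operatorname{Mp}(n)$ and $z_0\in\mathbb R^{2n}$ with $\widehat S\,\widehat T(z_0)\psi=\psi'$ up to a phase factor. -/

import Mathlib

open MeasureTheory Matrix
open scoped MatrixOrder FourierTransform

noncomputable section

namespace QuantumBlob

/-- Configuration space `ℝⁿ` with its Euclidean structure. -/
abbrev Config (n : ℕ) := EuclideanSpace ℝ (Fin n)

/-- Phase space `ℝ²ⁿ` with its Euclidean structure; a point is `z = (x, p)`, the coordinates of `x`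
being indexed by `Sum.inl` and those of `p` by `Sum.inr`. -/
abbrev Phase (n : ℕ) := EuclideanSpace ℝ (Fin n ⊕ Fin n)

/-- The Hilbert space `L²(ℝⁿ; ℂ)`. -/
abbrev L2 (n : ℕ) := Lp ℂ 2 (volume : Measure (Config n))

/-- The group of unitary operators on `L²(ℝⁿ; ℂ)`. -/
abbrev UnitaryOp (n : ℕ) := L2 n ≃ₗᵢ[ℂ] L2 n

/-- The symplectic group `Sp(n)` of real `2n × 2n` matrices. -/
abbrev Sp (n : ℕ) := Matrix.symplecticGroup (Fin n) ℝ

/-- The position component of `z = (x, p)`. -/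
def pos {n : ℕ} (z : Phase n) : Config n := WithLp.toLp 2 fun i => z (Sum.inl i)

/-- The momentum component of `z = (x, p)`. -/
def mom {n : ℕ} (z : Phase n) : Config n := WithLp.toLp 2 fun i => z (Sum.inr i)

/-- The quadratic form `M v · v` of a real matrix. -/
def quad {ι : Type*} [Fintype ι] (M : Matrix ι ι ℝ) (v : EuclideanSpace ℝ ι) : ℝ :=
  (M *ᵥ v.ofLp) ⬝ᵥ v.ofLp

/-- The linear map of a Euclidean space given by a square matrix. -/
def lin {ι : Type*} [Fintype ι] (M : Matrix ι ι ℝ) (v : EuclideanSpace ℝ ι) : EuclideanSpace ℝ ι :=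
  WithLp.toLp 2 (M *ᵥ v.ofLp)

@[simp]
theorem lin_one {ι : Type*} [Fintype ι] [DecidableEq ι] (v : EuclideanSpace ℝ ι) :
    lin 1 v = v := by
  simp [lin]

theorem lin_mul {ι : Type*} [Fintype ι] (M N : Matrix ι ι ℝ) (v : EuclideanSpace ℝ ι) :
    lin (M * N) v = lin M (lin N v) := by
  simp [lin, Matrix.mulVec_mulVec]

theorem lin_add {ι : Type*} [Fintype ι] (M : Matrix ι ι ℝ) (v w : EuclideanSpace ℝ ι) :
    lin M (v + w) = lin M v + lin M w := by
  simp [lin, Matrix.mulVec_add]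

/-! ### Phase space: symplectic and affine symplectic transformations, quantum blobs -/

/-- `Sp(n)` as a group of transformations of phase space. -/
def spMap (n : ℕ) : Sp n →* Equiv.Perm (Phase n) where
  toFun S :=
    { toFun := lin (S : Matrix (Fin n ⊕ Fin n) (Fin n ⊕ Fin n) ℝ)
      invFun := lin ((S⁻¹ : Sp n) : Matrix (Fin n ⊕ Fin n) (Fin n ⊕ Fin n) ℝ)
      left_inv := fun z => by
        rw [← lin_mul, ← Submonoid.coe_mul, inv_mul_cancel, Submonoid.coe_one, lin_one]
      right_inv := fun z => by
        rw [← lin_mul, ← Submonoid.coe_mul, mul_inv_cancel, Submonoid.coe_one, lin_one] }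
  map_one' := by ext1 z; exact lin_one z
  map_mul' S S' := by ext1 z; exact lin_mul _ _ z

/-- The phase space translation `T(z₀) : z ↦ z + z₀`. -/
def translation {n : ℕ} (z₀ : Phase n) : Equiv.Perm (Phase n) := Equiv.addRight z₀

theorem translation_mul_spMap {n : ℕ} (S : Sp n) (z₀ : Phase n) :
    spMap n S * translation z₀ = translation (spMap n S z₀) * spMap n S := by
  ext1 z
  exact lin_add _ z z₀

/-- The affine symplectic group `ISp(n)`: all products `S T(z₀)`, with `S ∈ Sp(n)` and
`z₀ ∈ ℝ²ⁿ`. -/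
def ISp (n : ℕ) : Subgroup (Equiv.Perm (Phase n)) where
  carrier := {f | ∃ (S : Sp n) (z₀ : Phase n), f = spMap n S * translation z₀}
  one_mem' := ⟨1, 0, by ext1 z; simp [translation]⟩
  mul_mem' := by
    rintro _ _ ⟨S, z, rfl⟩ ⟨S', z', rfl⟩
    refine ⟨S * S', z' + spMap n S'⁻¹ z, ?_⟩
    have h : translation z * spMap n S' = spMap n S' * translation (spMap n S'⁻¹ z) := by
      rw [translation_mul_spMap, map_inv, ← Equiv.Perm.mul_apply, mul_inv_cancel,
        Equiv.Perm.one_apply]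
    have h' : translation (spMap n S'⁻¹ z) * translation z'
        = translation (z' + spMap n S'⁻¹ z) := by
      ext1 v
      simp [translation, add_assoc]
    rw [map_mul, mul_assoc, ← mul_assoc _ _ (translation z'), h, mul_assoc, h', mul_assoc]
  inv_mem' := by
    rintro _ ⟨S, z, rfl⟩
    refine ⟨S⁻¹, spMap n S (-z), ?_⟩
    have h : (translation z)⁻¹ = translation (-z) := by
      ext1 v
      simp [translation, Equiv.Perm.inv_def]
    rw [_root_.mul_inv_rev, h, translation_mul_spMap, ← map_inv, ← Equiv.Perm.mul_apply,
      ← map_mul, inv_mul_cancel, map_one, Equiv.Perm.one_apply]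

/-- The set `QB(n)` of quantum blobs: the images of the balls `B²ⁿ(z₀, √ħ)` by symplectic
transformations. -/
def QB (n : ℕ) (ħ : ℝ) : Set (Set (Phase n)) :=
  {Q | ∃ (S : Sp n) (z₀ : Phase n), Q = spMap n S '' Metric.closedBall z₀ √ħ}

/-- The set `QB₀(n)` of centered quantum blobs. -/
def QB₀ (n : ℕ) (ħ : ℝ) : Set (Set (Phase n)) :=
  {Q | ∃ S : Sp n, Q = spMap n S '' Metric.closedBall 0 √ħ}

/-- The matrix `S_{AB}`, with blocks `A^{-1/2}`, `0`, `-B A^{-1/2}`, `A^{1/2}`. -/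
def matS {n : ℕ} (A B : Matrix (Fin n) (Fin n) ℝ) :
    Matrix (Fin n ⊕ Fin n) (Fin n ⊕ Fin n) ℝ :=
  Matrix.fromBlocks (CFC.sqrt A)⁻¹ 0 (-(B * (CFC.sqrt A)⁻¹)) (CFC.sqrt A)

/-- The matrix `G = (S_{AB} S_{AB}ᵀ)⁻¹`. -/
def matG {n : ℕ} (A B : Matrix (Fin n) (Fin n) ℝ) :
    Matrix (Fin n ⊕ Fin n) (Fin n ⊕ Fin n) ℝ :=
  (matS A B * (matS A B)ᵀ)⁻¹

/-! ### Unitary operators on `L²` of the form `ψ ↦ w · (ψ ∘ e)` -/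

section WeightedComp

variable {n : ℕ}

theorem eLpNorm_weightedComp (w : Config n → ℂ) (e : Config n ≃ᵐ Config n) {r : ℝ} (hr : 0 < r)
    (hw' : ∀ x, ‖w x‖ = r)
    (he : (volume : Measure (Config n)).map e = ENNReal.ofReal (r ^ 2)⁻¹ • volume)
    (f : Config n → ℂ) :
    eLpNorm (fun x => w x * f (e x)) 2 volume = eLpNorm f 2 volume := by
  have h1 : eLpNorm (fun x => w x * f (e x)) 2 volume
      = eLpNorm ((r : ℂ) • (f ∘ e)) 2 volume := by
    refine eLpNorm_congr_norm_ae (Filter.Eventually.of_forall fun x => ?_)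
    simp [hw', abs_of_pos hr]
  rw [h1, eLpNorm_const_smul, ← e.measurableEmbedding.eLpNorm_map_measure, he,
    eLpNorm_smul_measure_of_ne_top (by norm_num), smul_eq_mul, ← mul_assoc]
  have h2 : ‖(r : ℂ)‖ₑ = ENNReal.ofReal r := by
    rw [← ofReal_norm, Complex.norm_real, Real.norm_of_nonneg hr.le]
  have h3 : ENNReal.ofReal (r ^ 2)⁻¹ ^ (1 / (2 : ENNReal)).toReal = ENNReal.ofReal r⁻¹ := by
    rw [ENNReal.ofReal_rpow_of_pos (by positivity)]
    congr 1
    rw [← inv_pow, ENNReal.toReal_div, ENNReal.toReal_one, ENNReal.toReal_ofNat,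
      ← Real.sqrt_eq_rpow, Real.sqrt_sq (inv_nonneg.2 hr.le)]
  rw [h2, h3, ← ENNReal.ofReal_mul hr.le, mul_inv_cancel₀ hr.ne', ENNReal.ofReal_one, one_mul]

theorem memLp_weightedComp {w : Config n → ℂ} (hw : Measurable w) (e : Config n ≃ᵐ Config n)
    {r : ℝ} (hr : 0 < r) (hw' : ∀ x, ‖w x‖ = r)
    (he : (volume : Measure (Config n)).map e = ENNReal.ofReal (r ^ 2)⁻¹ • volume)
    {f : Config n → ℂ} (hf : MemLp f 2 volume) :
    MemLp (fun x => w x * f (e x)) 2 volume := by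
  refine ⟨hw.aestronglyMeasurable.mul ?_, ?_⟩
  · refine hf.1.comp_quasiMeasurePreserving ⟨e.measurable, ?_⟩
    rw [he]
    exact Measure.smul_absolutelyContinuous
  · rw [eLpNorm_weightedComp w e hr hw' he]
    exact hf.2

theorem ae_comp_of_map {e : Config n ≃ᵐ Config n} {c : ENNReal}
    (he : (volume : Measure (Config n)).map e = c • volume) {f g : Config n → ℂ}
    (h : f =ᵐ[volume] g) : ∀ᵐ x ∂(volume : Measure (Config n)), f (e x) = g (e x) := by
  refine Measure.QuasiMeasurePreserving.ae ⟨e.measurable, ?_⟩ h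
  rw [he]
  exact Measure.smul_absolutelyContinuous

theorem map_symm_of_map {e : Config n ≃ᵐ Config n} {r : ℝ} (hr : 0 < r)
    (he : (volume : Measure (Config n)).map e = ENNReal.ofReal (r ^ 2)⁻¹ • volume) :
    (volume : Measure (Config n)).map e.symm = ENNReal.ofReal (r⁻¹ ^ 2)⁻¹ • volume := by
  have h : (volume : Measure (Config n)) = ENNReal.ofReal (r ^ 2) • volume.map e := by
    rw [he, smul_smul, ← ENNReal.ofReal_mul (by positivity), mul_inv_cancel₀ (by positivity),
      ENNReal.ofReal_one, one_smul]
  conv_lhs => rw [h]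
  rw [Measure.map_smul, MeasurableEquiv.map_symm_map]
  simp

/-- The unitary operator `ψ ↦ w · (ψ ∘ e)`, where the weight `w` has constant modulus `r` and `e`
multiplies Lebesgue measure by `r²`. -/
def weightedComp (w : Config n → ℂ) (hw : Measurable w) (e : Config n ≃ᵐ Config n)
    (r : ℝ) (hr : 0 < r) (hw' : ∀ x, ‖w x‖ = r)
    (he : (volume : Measure (Config n)).map e = ENNReal.ofReal (r ^ 2)⁻¹ • volume) :
    UnitaryOp n :=
  LinearIsometryEquiv.ofSurjective
    { toFun := fun ψ => (memLp_weightedComp hw e hr hw' he (Lp.memLp ψ)).toLp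
      map_add' := fun ψ φ => by
        ext1
        filter_upwards [MemLp.coeFn_toLp (memLp_weightedComp hw e hr hw' he (Lp.memLp (ψ + φ))),
          MemLp.coeFn_toLp (memLp_weightedComp hw e hr hw' he (Lp.memLp ψ)),
          MemLp.coeFn_toLp (memLp_weightedComp hw e hr hw' he (Lp.memLp φ)),
          Lp.coeFn_add (MemLp.toLp _ (memLp_weightedComp hw e hr hw' he (Lp.memLp ψ)))
            (MemLp.toLp _ (memLp_weightedComp hw e hr hw' he (Lp.memLp φ))),
          ae_comp_of_map he (Lp.coeFn_add ψ φ)] with x h1 h2 h3 h4 h5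
        rw [h4, h1, Pi.add_apply, h2, h3, h5, Pi.add_apply, mul_add]
      map_smul' := fun c ψ => by
        ext1
        filter_upwards [MemLp.coeFn_toLp (memLp_weightedComp hw e hr hw' he (Lp.memLp (c • ψ))),
          MemLp.coeFn_toLp (memLp_weightedComp hw e hr hw' he (Lp.memLp ψ)),
          Lp.coeFn_smul c (MemLp.toLp _ (memLp_weightedComp hw e hr hw' he (Lp.memLp ψ))),
          ae_comp_of_map he (Lp.coeFn_smul c ψ)] with x h1 h2 h4 h5
        rw [RingHom.id_apply, h4, h1, Pi.smul_apply, h2, h5, Pi.smul_apply, smul_eq_mul,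
          smul_eq_mul]
        ring
      norm_map' := fun ψ => by
        rw [LinearMap.coe_mk, AddHom.coe_mk, Lp.norm_toLp, eLpNorm_weightedComp w e hr hw' he,
          Lp.norm_def] }
    (fun φ => by
      have hm : Measurable fun x => (w (e.symm x))⁻¹ := (hw.comp e.symm.measurable).inv
      have hφ := memLp_weightedComp hm e.symm (inv_pos.2 hr) (fun x => by simp [hw'])
        (map_symm_of_map hr he) (Lp.memLp φ)
      refine ⟨hφ.toLp, ?_⟩
      ext1
      refine (MemLp.coeFn_toLp (memLp_weightedComp hw e hr hw' he (Lp.memLp hφ.toLp))).trans ?_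
      filter_upwards [ae_comp_of_map he hφ.coeFn_toLp] with x h
      have hx : w x ≠ 0 := fun h0 => hr.ne' (by rw [← hw' x, h0, norm_zero])
      rw [h, MeasurableEquiv.symm_apply_apply, mul_inv_cancel_left₀ hx])

theorem weightedComp_apply (w : Config n → ℂ) (hw : Measurable w) (e : Config n ≃ᵐ Config n)
    (r : ℝ) (hr : 0 < r) (hw' : ∀ x, ‖w x‖ = r)
    (he : (volume : Measure (Config n)).map e = ENNReal.ofReal (r ^ 2)⁻¹ • volume) (ψ : L2 n) :
    weightedComp w hw e r hr hw' he ψ =ᵐ[volume] fun x => w x * ψ (e x) :=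
  MemLp.coeFn_toLp (memLp_weightedComp hw e hr hw' he (Lp.memLp ψ))

end WeightedComp

/-! ### The metaplectic group and the Heisenberg displacement operators -/

section Operators

variable {n : ℕ}

@[fun_prop]
theorem continuous_quad {ι : Type*} [Fintype ι] (M : Matrix ι ι ℝ) : Continuous (quad M) := by
  unfold quad dotProduct Matrix.mulVec dotProduct
  fun_prop

/-- The Heisenberg displacement operator
`T̂(x₀, p₀) ψ(x) = exp((i/ħ)(p₀ · x - ½ p₀ · x₀)) ψ(x - x₀)`. -/
def heisenberg (ħ : ℝ) (z₀ : Phase n) : UnitaryOp n :=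
  weightedComp
    (fun x => Complex.exp
      (((1 / ħ * (inner ℝ (mom z₀) x - 1 / 2 * inner ℝ (mom z₀) (pos z₀)) : ℝ) : ℂ) * Complex.I))
    (by fun_prop) (MeasurableEquiv.subRight (pos z₀)) 1 one_pos
    (fun x => Complex.norm_exp_ofReal_mul_I _)
    (by
      rw [one_pow, inv_one, ENNReal.ofReal_one, one_smul]
      exact (measurePreserving_sub_right volume (pos z₀)).map_eq)

theorem heisenberg_apply (ħ : ℝ) (z₀ : Phase n) (ψ : L2 n) :
    heisenberg ħ z₀ ψ =ᵐ[volume] fun x => Complex.exp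
      (((1 / ħ * (inner ℝ (mom z₀) x - 1 / 2 * inner ℝ (mom z₀) (pos z₀)) : ℝ) : ℂ) * Complex.I)
        * ψ (x - pos z₀) :=
  weightedComp_apply ..

/-- The operator `V̂_P ψ(x) = exp(-(i/2ħ) Px · x) ψ(x)`. -/
def opV (ħ : ℝ) (P : Matrix (Fin n) (Fin n) ℝ) : UnitaryOp n :=
  weightedComp (fun x => Complex.exp (((-(1 / (2 * ħ)) * quad P x : ℝ) : ℂ) * Complex.I))
    (by fun_prop) (MeasurableEquiv.refl _) 1 one_pos
    (fun x => Complex.norm_exp_ofReal_mul_I _)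
    (by
      rw [one_pow, inv_one, ENNReal.ofReal_one, one_smul]
      exact Measure.map_id)

theorem opV_apply (ħ : ℝ) (P : Matrix (Fin n) (Fin n) ℝ) (ψ : L2 n) :
    opV ħ P ψ =ᵐ[volume] fun x =>
      Complex.exp (((-(1 / (2 * ħ)) * quad P x : ℝ) : ℂ) * Complex.I) * ψ x :=
  weightedComp_apply ..

/-- An invertible matrix as a measurable automorphism of `ℝⁿ`. -/
def linEquiv (L : GL (Fin n) ℝ) : Config n ≃ᵐ Config n where
  toFun := lin (L : Matrix (Fin n) (Fin n) ℝ)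
  invFun := lin ((L⁻¹ : GL (Fin n) ℝ) : Matrix (Fin n) (Fin n) ℝ)
  left_inv := fun z => by rw [← lin_mul, Units.inv_mul, lin_one]
  right_inv := fun z => by rw [← lin_mul, Units.mul_inv, lin_one]
  measurable_toFun := (Matrix.toEuclideanLin
    (L : Matrix (Fin n) (Fin n) ℝ)).continuous_of_finiteDimensional.measurable
  measurable_invFun := (Matrix.toEuclideanLin
    ((L⁻¹ : GL (Fin n) ℝ) : Matrix (Fin n) (Fin n) ℝ)).continuous_of_finiteDimensional.measurable

theorem map_linEquiv (L : GL (Fin n) ℝ) :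
    (volume : Measure (Config n)).map (linEquiv L)
      = ENNReal.ofReal |(L : Matrix (Fin n) (Fin n) ℝ).det|⁻¹ • volume := by
  have hd : LinearMap.det (Matrix.toEuclideanLin (L : Matrix (Fin n) (Fin n) ℝ))
      = (L : Matrix (Fin n) (Fin n) ℝ).det := LinearMap.det_toLpLin 2 _
  have h := Measure.map_linearMap_addHaar_eq_smul_addHaar (volume : Measure (Config n))
    (f := Matrix.toEuclideanLin (L : Matrix (Fin n) (Fin n) ℝ))
    (by rw [hd]; exact (Matrix.isUnits_det_units L).ne_zero)
  rw [hd, abs_inv] at h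
  exact h

/-- The unitary operator `ψ ↦ c · (ψ ∘ L)`, where `|c|² = |det L|`. -/
def scaledComp (c : ℂ) (L : GL (Fin n) ℝ)
    (hc : ‖c‖ ^ 2 = |(L : Matrix (Fin n) (Fin n) ℝ).det|) : UnitaryOp n :=
  weightedComp (fun _ => c) measurable_const (linEquiv L) ‖c‖
    (norm_pos_iff.2 fun h => by
      rw [h, norm_zero, zero_pow two_ne_zero, eq_comm, abs_eq_zero] at hc
      exact (Matrix.isUnits_det_units L).ne_zero hc)
    (fun _ => rfl)
    (by rw [hc]; exact map_linEquiv L)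

theorem scaledComp_apply (c : ℂ) (L : GL (Fin n) ℝ)
    (hc : ‖c‖ ^ 2 = |(L : Matrix (Fin n) (Fin n) ℝ).det|) (ψ : L2 n) :
    scaledComp c L hc ψ =ᵐ[volume]
      fun x => c * ψ (lin (L : Matrix (Fin n) (Fin n) ℝ) x) :=
  weightedComp_apply ..

/-- The operator `M̂_{L,m} ψ(x) = iᵐ √|det L| ψ(Lx)`. -/
def opM (L : GL (Fin n) ℝ) (m : ℤ) : UnitaryOp n :=
  scaledComp (Complex.I ^ m * (√|(L : Matrix (Fin n) (Fin n) ℝ).det| : ℝ)) L (by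
    rw [norm_mul, norm_zpow, Complex.norm_I, _root_.one_zpow, one_mul, Complex.norm_real,
      Real.norm_of_nonneg (Real.sqrt_nonneg _), Real.sq_sqrt (abs_nonneg _)])

theorem opM_apply (L : GL (Fin n) ℝ) (m : ℤ) (ψ : L2 n) :
    opM L m ψ =ᵐ[volume] fun x =>
      Complex.I ^ m * (√|(L : Matrix (Fin n) (Fin n) ℝ).det| : ℝ)
        * ψ (lin (L : Matrix (Fin n) (Fin n) ℝ) x) :=
  scaledComp_apply ..

/-- The constant `(1/(2πiħ))^{n/2}` (principal branch). -/
def fourierConst (n : ℕ) (ħ : ℝ) : ℂ := (1 / (2 * Real.pi * Complex.I * ħ)) ^ ((n : ℂ) / 2)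

/-- The homothety of ratio `1/(2πħ)`. -/
def homothety (n : ℕ) {ħ : ℝ} (hħ : 0 < ħ) : GL (Fin n) ℝ :=
  Matrix.GeneralLinearGroup.mkOfDetNeZero ((2 * Real.pi * ħ)⁻¹ • (1 : Matrix (Fin n) (Fin n) ℝ))
    (by rw [Matrix.det_smul, Matrix.det_one, mul_one]; positivity)

theorem norm_fourierConst (n : ℕ) {ħ : ℝ} (hħ : 0 < ħ) :
    ‖fourierConst n ħ‖ ^ 2 = |(homothety n hħ : Matrix (Fin n) (Fin n) ℝ).det| := by
  have hdet : (homothety n hħ : Matrix (Fin n) (Fin n) ℝ).det = ((2 * Real.pi * ħ)⁻¹) ^ n := by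
    change ((2 * Real.pi * ħ)⁻¹ • (1 : Matrix (Fin n) (Fin n) ℝ)).det = _
    simp
  have he : ((n : ℂ) / 2) = (((n : ℝ) / 2 : ℝ) : ℂ) := by push_cast; rfl
  have hn : ‖(1 / (2 * Real.pi * Complex.I * ħ) : ℂ)‖ = (2 * Real.pi * ħ)⁻¹ := by
    simp [abs_of_pos Real.pi_pos, abs_of_pos hħ]
  rw [hdet, abs_of_pos (by positivity), fourierConst, he, Complex.norm_cpow_real, hn,
    ← Real.rpow_natCast, ← Real.rpow_natCast, ← Real.rpow_mul (by positivity)]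
  congr 1
  push_cast
  ring

/-- The operator `Ĵ ψ(x) = (1/(2πiħ))^{n/2} ∫ exp(-(i/ħ) x · x') ψ(x') dx'` on `L²`, that is, the
unitary Fourier transform `𝓕` of `L²` (with kernel `exp(-2πi x · x')`) followed by the substitution
`x ↦ x/(2πħ)` and multiplication by `(1/(2πiħ))^{n/2}`. -/
def opJ (n : ℕ) {ħ : ℝ} (hħ : 0 < ħ) : UnitaryOp n :=
  scaledComp (fourierConst n ħ) (homothety n hħ) (norm_fourierConst n hħ)
    * Lp.fourierTransformₗᵢ (Config n) ℂ

theorem opJ_apply {ħ : ℝ} (hħ : 0 < ħ) (f : SchwartzMap (Config n) ℂ) :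
    opJ n hħ (f.toLp 2) =ᵐ[volume] fun x => fourierConst n ħ *
      ∫ x' : Config n, Complex.exp (-(Complex.I / ħ) * (inner ℝ x x' : ℝ)) * f x' := by
  have h1 : Lp.fourierTransformₗᵢ (Config n) ℂ (f.toLp 2) = (𝓕 f).toLp 2 :=
    SchwartzMap.toLp_fourier_eq f
  have h2 : opJ n hħ (f.toLp 2) = scaledComp (fourierConst n ħ) (homothety n hħ)
      (norm_fourierConst n hħ) ((𝓕 f).toLp 2) := by
    rw [← h1]
    rfl
  rw [h2]
  filter_upwards [scaledComp_apply (fourierConst n ħ) (homothety n hħ)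
      (norm_fourierConst n hħ) ((𝓕 f).toLp 2),
    ae_comp_of_map (map_linEquiv (homothety n hħ))
      (SchwartzMap.coeFn_toLp (𝓕 f) 2 volume)] with x hx hx'
  have h3 : linEquiv (homothety n hħ) x = (2 * Real.pi * ħ)⁻¹ • x := by
    change lin ((2 * Real.pi * ħ)⁻¹ • (1 : Matrix (Fin n) (Fin n) ℝ)) x = _
    ext i
    simp [lin, Matrix.smul_mulVec]
  change _ = fourierConst n ħ * ((𝓕 f).toLp 2) (linEquiv (homothety n hħ) x) at hx
  rw [hx, hx', h3, SchwartzMap.fourier_coe, Real.fourier_eq']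
  congr 1
  refine integral_congr_ae (Filter.Eventually.of_forall fun v => ?_)
  have hħ' : (ħ : ℂ) ≠ 0 := by exact_mod_cast hħ.ne'
  have hpi : (Real.pi : ℂ) ≠ 0 := by exact_mod_cast Real.pi_ne_zero
  simp only [smul_eq_mul]
  congr 2
  rw [real_inner_smul_right, real_inner_comm]
  push_cast
  field_simp

/-- The metaplectic group `Mp(n)`: the group of unitary operators generated by `Ĵ`, the `V̂_P` with
`P` symmetric, and the `M̂_{L,m}` with `L` invertible and `mπ` an argument of `det L`. -/
def Mp (n : ℕ) {ħ : ℝ} (hħ : 0 < ħ) : Subgroup (UnitaryOp n) :=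
  Subgroup.closure
    ({opJ n hħ} ∪ {U | ∃ P : Matrix (Fin n) (Fin n) ℝ, P.IsSymm ∧ U = opV ħ P} ∪
      {U | ∃ (L : GL (Fin n) ℝ) (m : ℤ),
        (-1 : ℝ) ^ m * |(L : Matrix (Fin n) (Fin n) ℝ).det| = (L : Matrix (Fin n) (Fin n) ℝ).det ∧
          U = opM L m})

/-- The inhomogeneous metaplectic group `IMp(n)`: the group of unitary operators generated by
`Mp(n)` and the displacement operators `T̂(z₀)`. -/
def IMp (n : ℕ) {ħ : ℝ} (hħ : 0 < ħ) : Subgroup (UnitaryOp n) :=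
  Subgroup.closure ((Mp n hħ : Set (UnitaryOp n)) ∪ Set.range (heisenberg ħ))

theorem opJ_mem (n : ℕ) {ħ : ℝ} (hħ : 0 < ħ) : opJ n hħ ∈ Mp n hħ :=
  Subgroup.subset_closure (Or.inl (Or.inl rfl))

theorem opV_mem {ħ : ℝ} (hħ : 0 < ħ) {P : Matrix (Fin n) (Fin n) ℝ} (hP : P.IsSymm) :
    opV ħ P ∈ Mp n hħ :=
  Subgroup.subset_closure (Or.inl (Or.inr ⟨P, hP, rfl⟩))

theorem opM_mem {ħ : ℝ} (hħ : 0 < ħ) {L : GL (Fin n) ℝ} {m : ℤ}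
    (hm : (-1 : ℝ) ^ m * |(L : Matrix (Fin n) (Fin n) ℝ).det|
      = (L : Matrix (Fin n) (Fin n) ℝ).det) :
    opM L m ∈ Mp n hħ :=
  Subgroup.subset_closure (Or.inr ⟨L, m, hm, rfl⟩)

theorem Mp_mul_heisenberg_mem {ħ : ℝ} (hħ : 0 < ħ) (U : Mp n hħ) (z₀ : Phase n) :
    (U : UnitaryOp n) * heisenberg ħ z₀ ∈ IMp n hħ :=
  mul_mem (Subgroup.subset_closure (Or.inl U.2)) (Subgroup.subset_closure (Or.inr ⟨z₀, rfl⟩))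

theorem spMap_mul_translation_mem (S : Sp n) (z₀ : Phase n) :
    spMap n S * translation z₀ ∈ ISp n :=
  ⟨S, z₀, rfl⟩

end Operators

/-! ### Gaussian wavepackets and the Wigner transform -/

/-- The state `ψ_{AB}`: the set of all functions
`e^{iγ} (1/(πħ))^{n/4} (det A)^{1/4} exp(-(1/2ħ) (A + iB)x · x)` of `L²`, with `γ` real. -/
def wavepacket {n : ℕ} (ħ : ℝ) (A B : Matrix (Fin n) (Fin n) ℝ) : Set (L2 n) :=
  {ψ | ∃ γ : ℝ, ψ =ᵐ[volume] fun x =>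
    Complex.exp (γ * Complex.I) * (((1 / (Real.pi * ħ)) ^ ((n : ℝ) / 4) : ℝ) : ℂ)
      * ((A.det ^ (1 / 4 : ℝ) : ℝ) : ℂ)
      * Complex.exp (-(1 / (2 * ħ)) * (quad A x + Complex.I * quad B x))}

/-- The displaced state `T̂(z₀) ψ_{AB}`, as a set of functions that differ by phase factors. -/
def gaussState {n : ℕ} (ħ : ℝ) (z₀ : Phase n) (A B : Matrix (Fin n) (Fin n) ℝ) : Set (L2 n) :=
  heisenberg ħ z₀ '' wavepacket ħ A B

/-- The set `Gauss(n)` of Gaussian wavepackets `T̂(z₀) ψ_{AB}`, each up to a phase factor. -/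
def Gauss (n : ℕ) (ħ : ℝ) : Set (Set (L2 n)) :=
  {s | ∃ (z₀ : Phase n) (A B : Matrix (Fin n) (Fin n) ℝ),
    A.PosDef ∧ B.IsSymm ∧ s = gaussState ħ z₀ A B}

/-- The set `Gauss₀(n)` of centered Gaussian wavepackets `ψ_{AB}`, each up to a phase factor. -/
def Gauss₀ (n : ℕ) (ħ : ℝ) : Set (Set (L2 n)) :=
  {s | ∃ A B : Matrix (Fin n) (Fin n) ℝ, A.PosDef ∧ B.IsSymm ∧ s = wavepacket ħ A B}

/-- The Wigner transform
`Wψ(x, p) = (1/(2πħ))ⁿ ∫ exp(-(i/ħ) p · y) ψ(x + y/2) conj(ψ(x - y/2)) dy`. -/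
def wigner {n : ℕ} (ħ : ℝ) (ψ : Config n → ℂ) (z : Phase n) : ℂ :=
  (1 / (2 * Real.pi * ħ)) ^ n * ∫ y : Config n,
    Complex.exp (-(Complex.I / ħ) * (inner ℝ (mom z) y : ℝ))
      * ψ (pos z + (1 / 2 : ℝ) • y) * star (ψ (pos z - (1 / 2 : ℝ) • y))

end QuantumBlob

end

open QuantumBlob

namespace QuantumBlob

variable {n : ℕ}

/-! ### Covariance of the Wigner transform -/

/-! Everything rests on covariance of the Wigner transform: an operator `U` lies over a phase space
map `f` when `W(Uψ) ∘ f = Wψ` for all `ψ`. This relation is stable under products and inverses, so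
it need only be checked on generators: the displacements, `V̂_P`, `M̂_{L,m}` and `Ĵ`. Hence every
metaplectic operator lies over a symplectic map, and every element of `IMp(n)` over an affine
symplectic one.

The standard Gaussian has Wigner transform `(πħ)⁻ⁿ exp(-|z|²/ħ)`, and this determines it up to a
phase (`exists_phase_of_wigner_eq`). Its state is therefore cut out by a condition on Wigner
transforms, and an operator over `f` carries it to `stateOf ħ f`. As `ψ_{AB}` is obtained from the
standard Gaussian by `V̂_B M̂_{√A,0}`, which lies over `S_{AB}`, Gaussian states are of the form
`stateOf ħ f` with `f` in `ISp(n)`. Conversely, every such `stateOf ħ f` is Gaussian, because `S =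
S_{AB} O` with `O` orthogonal (`exists_eq_matS_mul_orthogonal`) and the radial profile does not see
`O`.

The map `Φ` sends a state to a superlevel set of its Wigner transform. So it is well defined and
equivariant from the start, and `stateOf ħ f` goes to `f(B(√ħ))`. It is injective because an element
of `ISp(n)` that preserves the ball preserves the norm, hence the state.

Testing on displaced Gaussians shows that `U` lies over only one map (`eq_of_wignerCovariant`). This
uniqueness makes the projections homomorphisms. They are onto because the images of the generators
generate `Sp(n)` (`subgroup_eq_top`). Transitivity is then formal: `f' f⁻¹` carries the object of
`f` to that of `f'`. -/

/-- `U` is a metaplectic-type operator over the phase space transformation `f`: the Wigner transform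
of `U ψ` is that of `ψ`, transported by `f`. -/
def WignerCovariant (ħ : ℝ) (U : UnitaryOp n) (f : Equiv.Perm (Phase n)) : Prop :=
  ∀ (ψ : L2 n) (z : Phase n), wigner ħ (U ψ) (f z) = wigner ħ ψ z

theorem WignerCovariant.one (ħ : ℝ) : WignerCovariant ħ (1 : UnitaryOp n) 1 := fun _ _ => rfl

theorem WignerCovariant.mul {ħ : ℝ} {U V : UnitaryOp n} {f g : Equiv.Perm (Phase n)}
    (hU : WignerCovariant ħ U f) (hV : WignerCovariant ħ V g) :
    WignerCovariant ħ (U * V) (f * g) := fun ψ z =>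
  (hU (V ψ) (g z)).trans (hV ψ z)

theorem WignerCovariant.inv {ħ : ℝ} {U : UnitaryOp n} {f : Equiv.Perm (Phase n)}
    (hU : WignerCovariant ħ U f) : WignerCovariant ħ U⁻¹ f⁻¹ := fun ψ z => by
  have h := hU (U⁻¹ ψ) (f⁻¹ z)
  have h1 : f (f⁻¹ z) = z := f.apply_symm_apply z
  have h2 : U (U⁻¹ ψ) = ψ := U.apply_symm_apply ψ
  rw [h1, h2] at h
  exact h.symm

theorem quasiMeasurePreserving_add_smul (x : Config n) {c : ℝ} (hc : c ≠ 0) :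
    Measure.QuasiMeasurePreserving (fun y : Config n => x + c • y) := by
  refine (measurePreserving_add_left volume x).quasiMeasurePreserving.comp ⟨by fun_prop, ?_⟩
  rw [Measure.map_addHaar_smul _ hc]
  exact Measure.smul_absolutelyContinuous

theorem quasiMeasurePreserving_sub_smul (x : Config n) {c : ℝ} (hc : c ≠ 0) :
    Measure.QuasiMeasurePreserving (fun y : Config n => x - c • y) := by
  simpa [sub_eq_add_neg] using quasiMeasurePreserving_add_smul x (neg_ne_zero.2 hc)

theorem wigner_congr_ae {ħ : ℝ} {ψ φ : Config n → ℂ} (h : ψ =ᵐ[volume] φ) (z : Phase n) :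
    wigner ħ ψ z = wigner ħ φ z := by
  unfold wigner
  congr 1
  refine integral_congr_ae ?_
  filter_upwards [(quasiMeasurePreserving_add_smul (pos z) (c := 1 / 2) (by norm_num)).ae h,
    (quasiMeasurePreserving_sub_smul (pos z) (c := 1 / 2) (by norm_num)).ae h] with y h1 h2
  rw [h1, h2]

theorem star_exp_ofReal_mul_I (t : ℝ) :
    star (Complex.exp (t * Complex.I)) = Complex.exp (((-t : ℝ) : ℂ) * Complex.I) := by
  rw [Complex.star_def, ← Complex.exp_conj]
  simp

/-- The phases at `x + y/2` and `x - y/2` combine to `exp((i/ħ) p₀ · y)`, which absorbs the shift of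
momentum; the constant `-½ p₀ · x₀` cancels against its conjugate. -/
theorem wignerCovariant_heisenberg (ħ : ℝ) (z₀ : Phase n) :
    WignerCovariant ħ (heisenberg ħ z₀) (translation z₀) := by
  intro ψ z
  rw [wigner_congr_ae (heisenberg_apply ħ z₀ ψ)]
  unfold wigner
  congr 2
  funext y
  have hp : pos (translation z₀ z) = pos z + pos z₀ := rfl
  have hm : mom (translation z₀ z) = mom z + mom z₀ := rfl
  have e1 : pos z + pos z₀ + (1 / 2 : ℝ) • y - pos z₀ = pos z + (1 / 2 : ℝ) • y := by abel
  have e2 : pos z + pos z₀ - (1 / 2 : ℝ) • y - pos z₀ = pos z - (1 / 2 : ℝ) • y := by abel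
  beta_reduce
  rw [hp, hm, e1, e2, star_mul', star_exp_ofReal_mul_I]
  have h : ∀ a b c d e : ℂ, a * (b * c) * (d * e) = (a * (b * d)) * c * e := by intros; ring
  rw [h, ← Complex.exp_add, ← Complex.exp_add]
  congr 3
  simp only [inner_add_left, inner_add_right, inner_sub_right, real_inner_smul_right]
  push_cast
  ring

/-- With `y/2` in place of `y`, this makes the difference of the two quadratic phases of `V̂_P`
linear in `y`, so that it acts as a shear of the momentum. -/
theorem quad_add_sub_quad_sub {P : Matrix (Fin n) (Fin n) ℝ} (hP : P.IsSymm) (x y : Config n) :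
    quad P (x + y) - quad P (x - y) = 4 * inner ℝ (lin P x) y := by
  have h : ∀ v w : Fin n → ℝ, (P *ᵥ v) ⬝ᵥ w = (P *ᵥ w) ⬝ᵥ v := fun v w => by
    rw [dotProduct_comm, Matrix.dotProduct_mulVec, ← Matrix.mulVec_transpose, hP]
  have h' : (inner ℝ (lin P x) y : ℝ) = (P *ᵥ x.ofLp) ⬝ᵥ y.ofLp := by
    simp [lin, EuclideanSpace.inner_eq_star_dotProduct, dotProduct_comm]
  rw [h']
  simp only [quad, WithLp.ofLp_add, WithLp.ofLp_sub, Matrix.mulVec_add, Matrix.mulVec_sub,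
    add_dotProduct, sub_dotProduct, dotProduct_add, dotProduct_sub, h y.ofLp x.ofLp]
  ring

/-! ### Symplectic generators, and covariance of `V̂_P` and `M̂_{L,m}` -/

theorem lowerShear_mem {P : Matrix (Fin n) (Fin n) ℝ} (hP : P.IsSymm) :
    (fromBlocks 1 0 P 1 : Matrix (Fin n ⊕ Fin n) (Fin n ⊕ Fin n) ℝ) ∈ Sp n := by
  rw [SymplecticGroup.fromBlocks_mem_iff]
  simp [hP.eq]

theorem diagonal_mem (L : GL (Fin n) ℝ) :
    (fromBlocks (L : Matrix (Fin n) (Fin n) ℝ)⁻¹ 0 0 (L : Matrix (Fin n) (Fin n) ℝ)ᵀ :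
      Matrix (Fin n ⊕ Fin n) (Fin n ⊕ Fin n) ℝ) ∈ Sp n := by
  rw [SymplecticGroup.fromBlocks_mem_iff]
  have h : (L : Matrix (Fin n) (Fin n) ℝ) * (L : Matrix (Fin n) (Fin n) ℝ)⁻¹ = 1 :=
    Matrix.mul_nonsing_inv _ (Matrix.isUnits_det_units L)
  simp [← Matrix.transpose_mul, h]

theorem quarterTurn_mem :
    (fromBlocks 0 1 (-1) 0 : Matrix (Fin n ⊕ Fin n) (Fin n ⊕ Fin n) ℝ) ∈ Sp n := by
  rw [SymplecticGroup.fromBlocks_mem_iff]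
  simp

theorem pos_lin_fromBlocks (a b c d : Matrix (Fin n) (Fin n) ℝ) (z : Phase n) :
    pos (lin (fromBlocks a b c d) z) = lin a (pos z) + lin b (mom z) := by
  ext i
  simp [pos, mom, lin, Matrix.fromBlocks_mulVec]
  rfl

theorem mom_lin_fromBlocks (a b c d : Matrix (Fin n) (Fin n) ℝ) (z : Phase n) :
    mom (lin (fromBlocks a b c d) z) = lin c (pos z) + lin d (mom z) := by
  ext i
  simp [pos, mom, lin, Matrix.fromBlocks_mulVec]
  rfl

@[simp]
theorem lin_zero_left {ι : Type*} [Fintype ι] (v : EuclideanSpace ℝ ι) : lin 0 v = 0 := by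
  simp [lin]

@[simp]
theorem lin_neg_left {ι : Type*} [Fintype ι] (M : Matrix ι ι ℝ) (v : EuclideanSpace ℝ ι) :
    lin (-M) v = -lin M v := by
  simp [lin, Matrix.neg_mulVec]

theorem lin_smul {ι : Type*} [Fintype ι] (M : Matrix ι ι ℝ) (c : ℝ) (v : EuclideanSpace ℝ ι) :
    lin M (c • v) = c • lin M v := by
  simp [lin, Matrix.mulVec_smul]

theorem lin_sub {ι : Type*} [Fintype ι] (M : Matrix ι ι ℝ) (v w : EuclideanSpace ℝ ι) :
    lin M (v - w) = lin M v - lin M w := by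
  simp [lin, Matrix.mulVec_sub]

theorem inner_lin_left {ι : Type*} [Fintype ι] (M : Matrix ι ι ℝ) (v w : EuclideanSpace ℝ ι) :
    inner ℝ (lin M v) w = (inner ℝ v (lin Mᵀ w) : ℝ) := by
  simp only [lin, EuclideanSpace.inner_eq_star_dotProduct, star_trivial]
  rw [Matrix.dotProduct_mulVec, Matrix.mulVec_transpose]

theorem wignerCovariant_opV (ħ : ℝ) {P : Matrix (Fin n) (Fin n) ℝ} (hP : P.IsSymm) :
    WignerCovariant ħ (opV ħ P)
      (spMap n ⟨fromBlocks 1 0 (-P) 1, lowerShear_mem hP.neg⟩) := by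
  intro ψ z
  rw [wigner_congr_ae (opV_apply ħ P ψ)]
  unfold wigner
  congr 2
  funext y
  change Complex.exp (_ * (inner ℝ (mom (lin (fromBlocks 1 0 (-P) 1) z)) y : ℝ)) *
    (Complex.exp (((_ * quad P (pos (lin (fromBlocks 1 0 (-P) 1) z) + _) : ℝ) : ℂ) * _) *
      ψ (pos (lin (fromBlocks 1 0 (-P) 1) z) + _)) *
    star (Complex.exp (((_ * quad P (pos (lin (fromBlocks 1 0 (-P) 1) z) - _) : ℝ) : ℂ) * _) *
      ψ (pos (lin (fromBlocks 1 0 (-P) 1) z) - _)) = _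
  simp only [pos_lin_fromBlocks, mom_lin_fromBlocks, lin_one, lin_zero_left, add_zero]
  rw [star_mul', star_exp_ofReal_mul_I]
  have h : ∀ a b c d e : ℂ, a * (b * c) * (d * e) = (a * (b * d)) * c * e := by intros; ring
  rw [h, ← Complex.exp_add, ← Complex.exp_add]
  congr 3
  have hq := quad_add_sub_quad_sub hP (pos z) ((1 / 2 : ℝ) • y)
  rw [real_inner_smul_right, sub_eq_iff_eq_add] at hq
  rw [hq, inner_add_left, lin_neg_left, inner_neg_left]
  push_cast
  ring

/-- After the substitution `y ↦ Ly` the Jacobian `|det L|⁻¹` cancels the weight `|det L|`, and `iᵐ`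
drops out because its modulus is one. -/
theorem wignerCovariant_opM (ħ : ℝ) (L : GL (Fin n) ℝ) (m : ℤ) :
    WignerCovariant ħ (opM L m) (spMap n ⟨_, diagonal_mem L⟩) := by
  intro ψ z
  rw [wigner_congr_ae (opM_apply L m ψ)]
  unfold wigner
  congr 1
  set M : Matrix (Fin n) (Fin n) ℝ := (L : Matrix (Fin n) (Fin n) ℝ) with hM
  have hdet : M.det ≠ 0 := (Matrix.isUnits_det_units L).ne_zero
  have hd : LinearMap.det (Matrix.toEuclideanLin M) = M.det := LinearMap.det_toLpLin 2 _
  have hLL : ∀ v, lin M (lin M⁻¹ v) = v := fun v => by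
    rw [← lin_mul, Matrix.mul_nonsing_inv _ (Matrix.isUnits_det_units L), lin_one]
  set g : Config n → ℂ := fun y => Complex.exp (-(Complex.I / ħ) * (inner ℝ (mom z) y : ℝ))
      * ψ (pos z + (1 / 2 : ℝ) • y) * star (ψ (pos z - (1 / 2 : ℝ) • y)) with hg
  have key : ∫ y, g (lin M y) = ((|M.det|⁻¹ : ℝ) : ℂ) * ∫ y, g y := by
    have := (linEquiv L).measurableEmbedding.integral_map (μ := volume) g
    rw [map_linEquiv, integral_smul_measure, ENNReal.toReal_ofReal (by positivity)] at this
    rw [← hM] at this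
    rw [← Complex.real_smul, this]
    rfl
  have hp : pos (spMap n ⟨_, diagonal_mem L⟩ z) = lin M⁻¹ (pos z) := by
    refine (pos_lin_fromBlocks _ _ _ _ z).trans ?_
    simp [hM]
  have hm : mom (spMap n ⟨_, diagonal_mem L⟩ z) = lin Mᵀ (mom z) := by
    refine (mom_lin_fromBlocks _ _ _ _ z).trans ?_
    simp [hM]
  rw [hp, hm]
  have : ∀ y : Config n, Complex.exp (-(Complex.I / ħ) * (inner ℝ (lin Mᵀ (mom z)) y : ℝ))
      * (Complex.I ^ m * ((√|M.det| : ℝ) : ℂ) * ψ (lin M (lin M⁻¹ (pos z) + (1 / 2 : ℝ) • y)))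
      * star (Complex.I ^ m * ((√|M.det| : ℝ) : ℂ) * ψ (lin M (lin M⁻¹ (pos z) - (1 / 2 : ℝ) • y)))
      = (|M.det| : ℝ) * g (lin M y) := by
    intro y
    have hI : (Complex.I ^ m * ((√|M.det| : ℝ) : ℂ)) * star (Complex.I ^ m * ((√|M.det| : ℝ) : ℂ))
        = (|M.det| : ℝ) := by
      rw [Complex.star_def, Complex.mul_conj, Complex.normSq_eq_norm_sq, norm_mul, norm_zpow,
        Complex.norm_I, _root_.one_zpow, one_mul, Complex.norm_real,
        Real.norm_of_nonneg (Real.sqrt_nonneg _), Real.sq_sqrt (abs_nonneg _)]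
    rw [star_mul', ← hI, lin_add, lin_sub, hLL, lin_smul, hg, inner_lin_left,
      Matrix.transpose_transpose]
    ring
  rw [integral_congr_ae (Filter.Eventually.of_forall this), integral_const_mul, key, ← mul_assoc, ← Complex.ofReal_mul,
    mul_inv_cancel₀ (abs_ne_zero.2 hdet), Complex.ofReal_one, one_mul]

/-! ### Covariance of the Fourier operator `Ĵ` -/

theorem hasTemperateGrowth_exp_ofReal_mul_I :
    (fun t : ℝ => Complex.exp (t * Complex.I)).HasTemperateGrowth := by
  have hd : ∀ t : ℝ, HasDerivAt (fun t : ℝ => Complex.exp (t * Complex.I))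
      (Complex.I * Complex.exp (t * Complex.I)) t := fun t => by
    have h := ((Complex.ofRealCLM.hasDerivAt (x := t)).mul_const Complex.I).cexp
    simpa [mul_comm] using h
  have hit : ∀ k : ℕ, iteratedDeriv k (fun t : ℝ => Complex.exp (t * Complex.I))
      = fun t : ℝ => Complex.I ^ k * Complex.exp (t * Complex.I) := by
    intro k
    induction k with
    | zero => simp
    | succ k ih =>
      rw [iteratedDeriv_succ, ih]
      funext t
      rw [((hd t).const_mul _).deriv, pow_succ, mul_assoc]
  refine ⟨(Complex.ofRealCLM.contDiff.mul contDiff_const).cexp, fun k => ⟨0, 1, fun t => ?_⟩⟩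
  rw [norm_iteratedFDeriv_eq_norm_iteratedDeriv, hit]
  simp

/-- The displacement of a Schwartz function. -/
noncomputable def schwartzDisplacement (ħ : ℝ) (z₀ : Phase n) (f : SchwartzMap (Config n) ℂ) :
    SchwartzMap (Config n) ℂ :=
  SchwartzMap.smulLeftCLM ℂ (fun x : Config n => Complex.exp
      (((1 / ħ * (inner ℝ (mom z₀) x - 1 / 2 * inner ℝ (mom z₀) (pos z₀)) : ℝ) : ℂ) * Complex.I))
    (SchwartzMap.compSubConstCLM ℂ (pos z₀) f)

theorem schwartzDisplacement_apply (ħ : ℝ) (z₀ : Phase n) (f : SchwartzMap (Config n) ℂ)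
    (x : Config n) :
    schwartzDisplacement ħ z₀ f x = Complex.exp
      (((1 / ħ * (inner ℝ (mom z₀) x - 1 / 2 * inner ℝ (mom z₀) (pos z₀)) : ℝ) : ℂ) * Complex.I)
        * f (x - pos z₀) := by
  unfold schwartzDisplacement
  rw [SchwartzMap.smulLeftCLM_apply_apply]
  · rw [SchwartzMap.compSubConstCLM_apply, smul_eq_mul]
  · refine hasTemperateGrowth_exp_ofReal_mul_I.comp (f := fun x : Config n =>
      1 / ħ * (inner ℝ (mom z₀) x - 1 / 2 * inner ℝ (mom z₀) (pos z₀))) ?_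
    exact (Function.HasTemperateGrowth.const _).mul
      ((Function.hasTemperateGrowth_inner_right (mom z₀)).sub (Function.HasTemperateGrowth.const _))

theorem heisenberg_toLp (ħ : ℝ) (z₀ : Phase n) (f : SchwartzMap (Config n) ℂ) :
    heisenberg ħ z₀ (f.toLp 2) = (schwartzDisplacement ħ z₀ f).toLp 2 := by
  ext1
  filter_upwards [heisenberg_apply ħ z₀ (f.toLp 2),
    SchwartzMap.coeFn_toLp (schwartzDisplacement ħ z₀ f) 2 volume,
    (measurePreserving_sub_right volume (pos z₀)).quasiMeasurePreserving.ae
      (SchwartzMap.coeFn_toLp f 2 volume)] with x h1 h2 h3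
  rw [h1, h2, h3, schwartzDisplacement_apply]

/-- The parity operator `ψ ↦ ψ(-·)`. -/
noncomputable def parity (n : ℕ) : UnitaryOp n := scaledComp 1 (-1 : GL (Fin n) ℝ) (by
  simp [Matrix.det_neg])

theorem parity_apply (ψ : L2 n) : parity n ψ =ᵐ[volume] fun x => ψ (-x) := by
  filter_upwards [scaledComp_apply 1 (-1 : GL (Fin n) ℝ) (by simp [Matrix.det_neg]) ψ] with x hx
  refine hx.trans ?_
  rw [one_mul, Units.val_neg, Units.val_one, lin_neg_left, lin_one]

/-- The reflection of a Schwartz function. -/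
noncomputable def schwartzReflection (f : SchwartzMap (Config n) ℂ) : SchwartzMap (Config n) ℂ :=
  SchwartzMap.compCLMOfContinuousLinearEquiv ℂ (ContinuousLinearEquiv.neg ℝ) f

theorem schwartzReflection_apply (f : SchwartzMap (Config n) ℂ) (x : Config n) :
    schwartzReflection f x = f (-x) := rfl

theorem parity_toLp (f : SchwartzMap (Config n) ℂ) :
    parity n (f.toLp 2) = (schwartzReflection f).toLp 2 := by
  ext1
  filter_upwards [parity_apply (f.toLp 2),
    SchwartzMap.coeFn_toLp (schwartzReflection f) 2 volume,
    (Measure.measurePreserving_neg volume).quasiMeasurePreserving.ae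
      (SchwartzMap.coeFn_toLp f 2 volume)] with x h1 h2 h3
  rw [h1, h2, h3, schwartzReflection_apply]

/-- Unitary operators that agree on Schwartz functions are equal. -/
theorem unitaryOp_ext_schwartz {U V : UnitaryOp n}
    (h : ∀ f : SchwartzMap (Config n) ℂ, U (f.toLp 2) = V (f.toLp 2)) : U = V := by
  have hd : DenseRange (SchwartzMap.toLpCLM ℂ ℂ 2 (volume : Measure (Config n))) :=
    SchwartzMap.denseRange_toLpCLM ENNReal.ofNat_ne_top
  ext1 ψ
  exact congrFun (hd.equalizer U.continuous V.continuous (funext fun f => h f)) ψ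

theorem unitaryOp_mul_apply (U V : UnitaryOp n) (ψ : L2 n) : (U * V) ψ = U (V ψ) := rfl

theorem parity_mul_opJ {ħ : ℝ} (hħ : 0 < ħ) : parity n * opJ n hħ = opJ n hħ * parity n := by
  refine unitaryOp_ext_schwartz fun f => ?_
  rw [unitaryOp_mul_apply, unitaryOp_mul_apply, parity_toLp]
  ext1
  filter_upwards [parity_apply (opJ n hħ (f.toLp 2)), opJ_apply hħ (schwartzReflection f),
    (Measure.measurePreserving_neg volume).quasiMeasurePreserving.ae (opJ_apply hħ f)]
    with x h1 h2 h3
  rw [h1, h2, h3]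
  congr 1
  rw [← integral_neg_eq_self]
  simp [schwartzReflection_apply]

/-- Fourier transform exchanges translation and modulation. The symmetric constant `-½ p₀ · x₀` in
the displacement makes the intertwining exact, without a leftover phase. Density reduces the claim
to Schwartz functions, where `Ĵ` is an honest integral. -/
theorem heisenberg_mul_opJ {ħ : ℝ} (hħ : 0 < ħ) (z : Phase n) :
    heisenberg ħ (lin (fromBlocks 0 1 (-1) 0) z) * opJ n hħ = opJ n hħ * heisenberg ħ z := by
  refine unitaryOp_ext_schwartz fun f => ?_
  rw [unitaryOp_mul_apply, unitaryOp_mul_apply, heisenberg_toLp]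
  have hp : pos (lin (fromBlocks 0 1 (-1) 0) z) = mom z := by
    rw [pos_lin_fromBlocks, lin_zero_left, lin_one, zero_add]
  have hm : mom (lin (fromBlocks 0 1 (-1) 0) z) = -pos z := by
    rw [mom_lin_fromBlocks, lin_zero_left, lin_neg_left, lin_one, add_zero]
  ext1
  have h1 := heisenberg_apply ħ (lin (fromBlocks 0 1 (-1) 0) z) (opJ n hħ (f.toLp 2))
  rw [hp, hm] at h1
  filter_upwards [h1, opJ_apply hħ (schwartzDisplacement ħ z f),
    (measurePreserving_sub_right volume (mom z)).quasiMeasurePreserving.ae (opJ_apply hħ f)]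
    with x h1 h2 h3
  rw [h1, h2, h3, mul_left_comm]
  congr 1
  rw [← integral_const_mul, ← integral_sub_right_eq_self _ (pos z)]
  refine integral_congr_ae (Filter.Eventually.of_forall fun u => ?_)
  beta_reduce
  rw [schwartzDisplacement_apply, ← mul_assoc, ← mul_assoc,
    ← Complex.exp_add, ← Complex.exp_add]
  congr 2
  simp only [inner_sub_right, inner_sub_left, inner_neg_right, real_inner_comm (mom z),
    real_inner_comm x]
  push_cast
  ring

/-- At the origin the Wigner transform is, up to a constant, the expectation of parity; `2ⁿ` is the
Jacobian of `y ↦ y/2`. -/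
theorem wigner_zero (ħ : ℝ) (ψ : L2 n) :
    wigner ħ ψ 0 = (1 / (2 * Real.pi * ħ)) ^ n * (2 ^ n * inner ℂ (parity n ψ) ψ) := by
  unfold wigner
  have hp : pos (0 : Phase n) = 0 := rfl
  have hm : mom (0 : Phase n) = 0 := rfl
  congr 1
  rw [hp, hm]
  have h1 : inner ℂ (parity n ψ) ψ = ∫ y : Config n, ψ y * star (ψ (-y)) := by
    rw [L2.inner_def]
    refine integral_congr_ae ?_
    filter_upwards [parity_apply ψ] with y hy
    rw [hy, RCLike.inner_apply]
    rfl
  have h2 := Measure.integral_comp_smul (volume : Measure (Config n))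
    (fun y => ψ y * star (ψ (-y))) (1 / 2 : ℝ)
  rw [h1]
  simp only [inner_zero_left, Complex.ofReal_zero, mul_zero, Complex.exp_zero, one_mul, zero_add,
    zero_sub]
  rw [h2]
  simp

/-- Displacing `z` to the origin expresses `Wψ(z)` as an inner product involving only parity and
displacement. `Ĵ` commutes with the former, intertwines the latter and is unitary, so no double
integral has to be manipulated for general `L²` functions. -/
theorem wignerCovariant_opJ {ħ : ℝ} (hħ : 0 < ħ) :
    WignerCovariant ħ (opJ n hħ) (spMap n ⟨_, quarterTurn_mem⟩) := by
  have hz : ∀ (ψ : L2 n) (z : Phase n), wigner ħ ψ z = wigner ħ (heisenberg ħ (-z) ψ) 0 := by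
    intro ψ z
    rw [← wignerCovariant_heisenberg ħ (-z) ψ z]
    congr 1
    simp [translation]
  intro ψ z
  have hneg : -(spMap n ⟨_, quarterTurn_mem⟩ z) = lin (fromBlocks 0 1 (-1) 0) (-z) := by
    rw [← neg_one_smul ℝ z, lin_smul, neg_one_smul]
    rfl
  have hJ : heisenberg ħ (lin (fromBlocks 0 1 (-1) 0) (-z)) (opJ n hħ ψ)
      = opJ n hħ (heisenberg ħ (-z) ψ) :=
    by rw [← unitaryOp_mul_apply, heisenberg_mul_opJ, unitaryOp_mul_apply]
  have hR : ∀ φ : L2 n, parity n (opJ n hħ φ) = opJ n hħ (parity n φ) := fun φ =>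
    by rw [← unitaryOp_mul_apply, parity_mul_opJ, unitaryOp_mul_apply]
  rw [hz, hz ψ, hneg, hJ, wigner_zero, wigner_zero, hR, LinearIsometryEquiv.inner_map_map]

/-! ### The Wigner transform determines the state -/

/-- An integrable function with vanishing Fourier transform vanishes almost everywhere. -/
theorem ae_eq_zero_of_fourier_eq_zero {f : Config n → ℂ} (hf : Integrable f)
    (h : ∀ w, 𝓕 f w = 0) : ∀ᵐ x, f x = 0 := by
  refine ae_eq_zero_of_integral_contDiff_smul_eq_zero hf.locallyIntegrable fun g hg hgs => ?_
  have hgs' : HasCompactSupport fun x => (g x : ℂ) := hgs.comp_left Complex.ofReal_zero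
  set G : SchwartzMap (Config n) ℂ :=
    hgs'.toSchwartzMap (Complex.ofRealCLM.contDiff.comp hg) with hG
  -- The multiplication formula `∫ 𝓕f · h = ∫ f · 𝓕h` with `h = 𝓕⁻ G`: the left side vanishes and
  -- the right side is the integral of `f` against the test function.
  have h1 := VectorFourier.integral_fourierIntegral_smul_eq_flip (L := innerₗ (Config n))
    Real.continuous_fourierChar continuous_inner hf
    (SchwartzMap.integrable (μ := volume) (𝓕⁻ G))
  have h2 : ∀ x, VectorFourier.fourierIntegral Real.fourierChar volume (innerₗ (Config n)).flip
      (𝓕⁻ G : SchwartzMap (Config n) ℂ) x = g x := fun x => by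
    have h3 : 𝓕 (𝓕⁻ G) = G := FourierTransform.fourier_fourierInv_eq G
    have h4 : (𝓕 (𝓕⁻ G)) x = G x := by rw [h3]
    rw [SchwartzMap.fourier_coe] at h4
    rw [flip_innerₗ]
    exact h4
  have h5 : ∀ w, VectorFourier.fourierIntegral Real.fourierChar volume (innerₗ (Config n)) f w
      = 0 := h
  simp only [h2, h5, zero_smul, integral_zero] at h1
  rw [h1]
  refine integral_congr_ae (Filter.Eventually.of_forall fun x => ?_)
  simp [mul_comm]

theorem memLp_comp_add_smul {ψ : Config n → ℂ} (hψ : MemLp ψ 2 volume) (x : Config n) {c : ℝ}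
    (hc : c ≠ 0) : MemLp (fun y => ψ (x + c • y)) 2 volume := by
  have hm : (volume : Measure (Config n)).map (fun y => x + c • y)
      = ENNReal.ofReal |(c ^ Module.finrank ℝ (Config n))⁻¹| • volume := by
    have h : (fun y : Config n => x + c • y) = (fun y => x + y) ∘ (fun y => c • y) := rfl
    rw [h, ← Measure.map_map (by fun_prop) (by fun_prop), Measure.map_addHaar_smul _ hc,
      Measure.map_smul, (measurePreserving_add_left volume x).map_eq]
  have h1 : MemLp ψ 2 ((volume : Measure (Config n)).map (fun y => x + c • y)) := by
    rw [hm]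
    exact hψ.smul_measure ENNReal.ofReal_ne_top
  exact (memLp_map_measure_iff h1.1 (by fun_prop)).1 h1

theorem integrable_wigner_integrand {ψ : Config n → ℂ} (hψ : MemLp ψ 2 volume) (x : Config n) :
    Integrable fun y : Config n => ψ (x + (1 / 2 : ℝ) • y) * star (ψ (x - (1 / 2 : ℝ) • y)) := by
  have h1 := memLp_comp_add_smul hψ x (c := 1 / 2) (by norm_num)
  have h2 := (memLp_comp_add_smul hψ x (c := -(1 / 2)) (by norm_num)).star
  refine (h1.integrable_mul h2).congr (Filter.Eventually.of_forall fun y => ?_)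
  simp [sub_eq_add_neg]

theorem wigner_eq_fourier {ħ : ℝ} (hħ : 0 < ħ) (ψ : Config n → ℂ) (z : Phase n) :
    wigner ħ ψ z = (1 / (2 * Real.pi * ħ)) ^ n
      * 𝓕 (fun y => ψ (pos z + (1 / 2 : ℝ) • y) * star (ψ (pos z - (1 / 2 : ℝ) • y)))
        ((2 * Real.pi * ħ)⁻¹ • mom z) := by
  unfold wigner
  congr 1
  rw [Real.fourier_eq']
  refine integral_congr_ae (Filter.Eventually.of_forall fun y => ?_)
  beta_reduce
  rw [smul_eq_mul, mul_assoc]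
  congr 2
  have hħ' : (ħ : ℂ) ≠ 0 := by exact_mod_cast hħ.ne'
  have hpi : (Real.pi : ℂ) ≠ 0 := by exact_mod_cast Real.pi_ne_zero
  rw [real_inner_smul_right, real_inner_comm]
  push_cast
  field_simp

/-- For a fixed position the Wigner transform is a Fourier transform in the momentum, so injectivity
of the Fourier transform on integrable functions applies. -/
theorem ae_mul_star_eq_of_wigner_eq {ħ : ℝ} (hħ : 0 < ħ) {ψ φ : Config n → ℂ}
    (hψ : MemLp ψ 2 volume) (hφ : MemLp φ 2 volume)
    (h : ∀ z, wigner ħ ψ z = wigner ħ φ z) (x : Config n) :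
    ∀ᵐ y : Config n, ψ (x + (1 / 2 : ℝ) • y) * star (ψ (x - (1 / 2 : ℝ) • y))
      = φ (x + (1 / 2 : ℝ) • y) * star (φ (x - (1 / 2 : ℝ) • y)) := by
  have h1 := integrable_wigner_integrand hψ x
  have h2 := integrable_wigner_integrand hφ x
  have h3 := ae_eq_zero_of_fourier_eq_zero (h1.sub h2) fun w => by
    -- The momentum `2πħ w` is the one for which the Fourier frequency is `w`.
    have hz := h (WithLp.toLp 2 (Sum.elim x.ofLp ((2 * Real.pi * ħ) • w).ofLp))
    rw [wigner_eq_fourier hħ, wigner_eq_fourier hħ] at hz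
    have hc : ((1 / (2 * Real.pi * ħ)) ^ n : ℂ) ≠ 0 := by
      have : (ħ : ℂ) ≠ 0 := by exact_mod_cast hħ.ne'
      have hpi : (Real.pi : ℂ) ≠ 0 := by exact_mod_cast Real.pi_ne_zero
      exact pow_ne_zero _ (one_div_ne_zero (mul_ne_zero (mul_ne_zero two_ne_zero hpi) this))
    have hp : pos (WithLp.toLp 2 (Sum.elim x.ofLp ((2 * Real.pi * ħ) • w).ofLp)) = x := rfl
    have hm : mom (WithLp.toLp 2 (Sum.elim x.ofLp ((2 * Real.pi * ħ) • w).ofLp))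
      = (2 * Real.pi * ħ) • w := rfl
    have hz' := mul_left_cancel₀ hc hz
    rw [hp, hm, smul_smul, inv_mul_cancel₀ (by positivity), one_smul, Real.fourier_eq,
      Real.fourier_eq] at hz'
    rw [Real.fourier_eq, ← sub_eq_zero.2 hz', ← integral_sub]
    · simp [smul_sub]
    · exact (Real.fourierIntegral_convergent_iff w).2 h1
    · exact (Real.fourierIntegral_convergent_iff w).2 h2
  filter_upwards [h3] with y hy
  exact sub_eq_zero.1 hy

/-- Two functions with the same Wigner transform differ by a phase. -/
theorem exists_phase_of_wigner_eq {ħ : ℝ} (hħ : 0 < ħ) {ψ φ : Config n → ℂ}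
    (hψ : MemLp ψ 2 volume) (hφ : MemLp φ 2 volume) (hψ' : Measurable ψ) (hφ' : Measurable φ)
    (hne : ∀ x, φ x ≠ 0) (h : ∀ z, wigner ħ ψ z = wigner ħ φ z) :
    ∃ γ : ℝ, ψ =ᵐ[volume] fun x => Complex.exp (γ * Complex.I) * φ x := by
  have h1 : ∀ x : Config n, ∀ᵐ v : Config n,
      ψ ((2 : ℝ) • x - v) * star (ψ v) = φ ((2 : ℝ) • x - v) * star (φ v) := fun x => by
    have h2 := ae_mul_star_eq_of_wigner_eq hħ hψ hφ h x
    -- The substitution `y = 2x - 2v` turns the second argument into `v` alone.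
    filter_upwards [(quasiMeasurePreserving_sub_smul ((2 : ℝ) • x) (c := 2) two_ne_zero).ae h2]
      with v hv
    have e1 : x + (1 / 2 : ℝ) • ((2 : ℝ) • x - (2 : ℝ) • v) = (2 : ℝ) • x - v := by module
    have e2 : x - (1 / 2 : ℝ) • ((2 : ℝ) • x - (2 : ℝ) • v) = v := by module
    rwa [e1, e2] at hv
  have hms : MeasurableSet {q : Config n × Config n | ψ ((2 : ℝ) • q.1 - q.2) * star (ψ q.2)
      = φ ((2 : ℝ) • q.1 - q.2) * star (φ q.2)} := by
    refine measurableSet_eq_fun ?_ ?_ <;> fun_prop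
  -- Fubini for null sets lets `v` be fixed first; then `u = 2x - v` sweeps all of space as `x`
  -- varies.
  have h2 := (Measure.ae_ae_comm (μ := volume) (ν := volume) hms).1
    (Filter.Eventually.of_forall h1)
  have h3 : ∀ᵐ v : Config n, ∀ᵐ u : Config n, ψ u * star (ψ v) = φ u * star (φ v) := by
    filter_upwards [h2] with v hv
    filter_upwards [(quasiMeasurePreserving_add_smul ((1 / 2 : ℝ) • v) (c := 1 / 2)
      (by norm_num)).ae hv] with u hu
    have e : (2 : ℝ) • ((1 / 2 : ℝ) • v + (1 / 2 : ℝ) • u) - v = u := by module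
    rwa [e] at hu
  obtain ⟨v, hv⟩ := h3.exists
  have hψv : star (ψ v) ≠ 0 := fun h0 => by
    obtain ⟨u, hu⟩ := hv.exists
    rw [h0, mul_zero] at hu
    exact mul_ne_zero (hne u) (star_ne_zero.2 (hne v)) hu.symm
  set c : ℂ := star (φ v) / star (ψ v) with hc
  have h4 : ∀ᵐ u : Config n, ψ u = c * φ u := by
    filter_upwards [hv] with u hu
    rw [hc]
    field_simp
    rw [hu, mul_comm]
  -- Inserting `ψ = cφ` into `ψ(u) ψ(w)* = φ(u) φ(w)*` at a good pair of points leaves `c c* = 1`.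
  have hc1 : ‖c‖ = 1 := by
    obtain ⟨w, hw, hw'⟩ := (h3.and h4).exists
    obtain ⟨u, hu, hu'⟩ := (hw.and h4).exists
    rw [hu', hw', star_mul'] at hu
    have hne' : φ u * star (φ w) ≠ 0 := mul_ne_zero (hne u) (star_ne_zero.2 (hne w))
    have h5 : c * star c = 1 := by
      apply mul_right_cancel₀ hne'
      linear_combination hu
    have h6 := congrArg norm h5
    rw [norm_mul, norm_star, norm_one] at h6
    nlinarith [norm_nonneg c]
  refine ⟨c.arg, ?_⟩
  filter_upwards [h4] with u hu
  rw [hu]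
  congr 1
  have := Complex.norm_mul_exp_arg_mul_I c
  rw [hc1, Complex.ofReal_one, one_mul] at this
  exact this.symm

/-! ### Gaussian states through their Wigner transforms -/

/-- The states whose Wigner transform is the standard Gaussian, transported by `f`. -/
def stateOf (ħ : ℝ) (f : Equiv.Perm (Phase n)) : Set (L2 n) :=
  {ψ | ∀ z : Phase n, wigner ħ ψ (f z)
    = (((1 / (Real.pi * ħ)) ^ n * Real.exp (-(1 / ħ) * ‖z‖ ^ 2) : ℝ) : ℂ)}

/-- Covariance holds for every `ψ` and `U` is onto, so the defining condition transports in both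
directions. -/
theorem WignerCovariant.image_stateOf {ħ : ℝ} {U : UnitaryOp n} {f : Equiv.Perm (Phase n)}
    (hU : WignerCovariant ħ U f) (g : Equiv.Perm (Phase n)) :
    U '' stateOf ħ g = stateOf ħ (f * g) := by
  ext φ
  constructor
  · rintro ⟨ψ, hψ, rfl⟩ z
    exact (hU ψ (g z)).trans (hψ z)
  · intro hφ
    refine ⟨U.symm φ, fun z => ?_, U.apply_symm_apply φ⟩
    rw [← hU (U.symm φ) (g z), U.apply_symm_apply]
    exact hφ z

/-! ### The standard Gaussian and its Wigner transform -/

/-- The standard Gaussian. -/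
noncomputable def stdGaussian (n : ℕ) (ħ : ℝ) (x : Config n) : ℂ :=
  (((1 / (Real.pi * ħ)) ^ ((n : ℝ) / 4) : ℝ) : ℂ) * Complex.exp (-(1 / (2 * ħ)) * ‖x‖ ^ 2)

theorem quad_one {ι : Type*} [Fintype ι] [DecidableEq ι] (v : EuclideanSpace ℝ ι) :
    quad 1 v = ‖v‖ ^ 2 := by
  rw [quad, Matrix.one_mulVec, ← real_inner_self_eq_norm_sq,
    EuclideanSpace.inner_eq_star_dotProduct, star_trivial]

theorem quad_zero {ι : Type*} [Fintype ι] (v : EuclideanSpace ℝ ι) : quad 0 v = 0 := by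
  simp [quad]

theorem quad_lin {ι : Type*} [Fintype ι] (M N : Matrix ι ι ℝ) (v : EuclideanSpace ℝ ι) :
    quad M (lin N v) = quad (Nᵀ * M * N) v := by
  simp only [quad, lin, Matrix.mulVec_mulVec]
  rw [Matrix.mul_assoc, ← Matrix.mulVec_mulVec _ Nᵀ, Matrix.mulVec_transpose,
    ← Matrix.dotProduct_mulVec]

theorem measurable_stdGaussian (n : ℕ) (ħ : ℝ) : Measurable (stdGaussian n ħ) := by
  unfold stdGaussian
  fun_prop

theorem stdGaussian_ne_zero (n : ℕ) {ħ : ℝ} (hħ : 0 < ħ) (x : Config n) :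
    stdGaussian n ħ x ≠ 0 := by
  refine mul_ne_zero ?_ (Complex.exp_ne_zero _)
  have := Real.pi_pos
  exact Complex.ofReal_ne_zero.2 (Real.rpow_pos_of_pos (by positivity) _).ne'

theorem stdGaussian_mul_star (n : ℕ) (ħ : ℝ) (x y : Config n) :
    stdGaussian n ħ x * star (stdGaussian n ħ y)
      = (((1 / (Real.pi * ħ)) ^ ((n : ℝ) / 4) : ℝ) : ℂ) ^ 2
        * Complex.exp (-(1 / (2 * ħ)) * (‖x‖ ^ 2 + ‖y‖ ^ 2)) := by
  have h : star (Complex.exp (-(1 / (2 * ħ)) * ‖y‖ ^ 2))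
      = Complex.exp (-(1 / (2 * ħ)) * ‖y‖ ^ 2) := by
    have h' : (-(1 / (2 * ħ)) * ‖y‖ ^ 2 : ℂ) = ((-(1 / (2 * ħ)) * ‖y‖ ^ 2 : ℝ) : ℂ) := by
      push_cast
      rfl
    rw [Complex.star_def, ← Complex.exp_conj, h', Complex.conj_ofReal]
  rw [stdGaussian, stdGaussian, star_mul', h, Complex.star_def, Complex.conj_ofReal, mul_add,
    Complex.exp_add]
  ring

theorem memLp_stdGaussian (n : ℕ) {ħ : ℝ} (hħ : 0 < ħ) : MemLp (stdGaussian n ħ) 2 volume := by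
  rw [memLp_two_iff_integrable_sq_norm (measurable_stdGaussian n ħ).aestronglyMeasurable]
  have h := (GaussianFourier.integrable_cexp_neg_mul_sq_norm_add (V := Config n) (b := 1 / ħ)
    (by simpa using hħ) 0 0).const_mul
      ((((1 / (Real.pi * ħ)) ^ ((n : ℝ) / 4) : ℝ) : ℂ) ^ 2)
  refine (h.norm).congr (Filter.Eventually.of_forall fun x => ?_)
  beta_reduce
  have h2 : ‖stdGaussian n ħ x‖ ^ 2 = ‖stdGaussian n ħ x * star (stdGaussian n ħ x)‖ := by
    rw [norm_mul, norm_star, sq]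
  rw [h2, stdGaussian_mul_star]
  congr 3
  rw [zero_mul, add_zero]
  field_simp
  norm_num

/-- By the parallelogram law the exponents at `x ± y/2` add up to `2|x|² + ½|y|²`, which separates
`x` from a Gaussian Fourier integral in `y`. -/
theorem wigner_stdGaussian (n : ℕ) {ħ : ℝ} (hħ : 0 < ħ) (z : Phase n) :
    wigner ħ (stdGaussian n ħ) z
      = (((1 / (Real.pi * ħ)) ^ n * Real.exp (-(1 / ħ) * ‖z‖ ^ 2) : ℝ) : ℂ) := by
  have hħ' : (ħ : ℂ) ≠ 0 := by exact_mod_cast hħ.ne'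
  have hpi := Real.pi_pos
  have hz : ‖z‖ ^ 2 = ‖pos z‖ ^ 2 + ‖mom z‖ ^ 2 := by
    simp [EuclideanSpace.norm_sq_eq, pos, mom, Fintype.sum_sum_type]
  unfold wigner
  have h1 : ∀ y : Config n, Complex.exp (-(Complex.I / ħ) * (inner ℝ (mom z) y : ℝ))
      * stdGaussian n ħ (pos z + (1 / 2 : ℝ) • y) * star (stdGaussian n ħ (pos z - (1 / 2 : ℝ) • y))
      = ((((1 / (Real.pi * ħ)) ^ ((n : ℝ) / 4) : ℝ) : ℂ) ^ 2
          * Complex.exp (-(1 / ħ) * ‖pos z‖ ^ 2))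
        * Complex.exp (-(1 / (4 * ħ)) * ‖y‖ ^ 2 + -(Complex.I / ħ) * (inner ℝ (mom z) y : ℝ)) := by
    intro y
    have hpar : ‖pos z + (1 / 2 : ℝ) • y‖ ^ 2 + ‖pos z - (1 / 2 : ℝ) • y‖ ^ 2
        = 2 * ‖pos z‖ ^ 2 + 1 / 2 * ‖y‖ ^ 2 := by
      rw [norm_add_sq_real, norm_sub_sq_real, norm_smul]
      norm_num
      ring
    have hpar' := congrArg (fun t : ℝ => (t : ℂ)) hpar
    push_cast at hpar'
    rw [mul_assoc, stdGaussian_mul_star, hpar', mul_left_comm, mul_assoc, ← Complex.exp_add,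
      ← Complex.exp_add]
    congr 2
    field_simp
    ring
  have hb : 0 < ((1 / (4 * ħ) : ℂ)).re := by
    have : (1 / (4 * ħ) : ℂ) = ((1 / (4 * ħ) : ℝ) : ℂ) := by push_cast; rfl
    rw [this, Complex.ofReal_re]
    positivity
  rw [integral_congr_ae (Filter.Eventually.of_forall h1), integral_const_mul,
    GaussianFourier.integral_cexp_neg_mul_sq_norm_add hb, finrank_euclideanSpace_fin]
  have h2 : ((Real.pi : ℂ) / (1 / (4 * ħ))) ^ ((n : ℂ) / 2)
      = (((4 * Real.pi * ħ) ^ ((n : ℝ) / 2) : ℝ) : ℂ) := by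
    rw [Complex.ofReal_cpow (by positivity)]
    congr 1
    · push_cast
      field_simp
    · push_cast
      rfl
  -- The squared normalization times the Gaussian integral is `4^{n/2} = 2ⁿ`, which turns `(2πħ)⁻ⁿ`
  -- into `(πħ)⁻ⁿ`.
  have h3 : (1 / (2 * Real.pi * ħ)) ^ n * (((1 / (Real.pi * ħ)) ^ ((n : ℝ) / 4)) ^ 2
      * (4 * Real.pi * ħ) ^ ((n : ℝ) / 2)) = (1 / (Real.pi * ħ)) ^ n := by
    rw [← Real.rpow_natCast ((1 / (Real.pi * ħ)) ^ ((n : ℝ) / 4)), ← Real.rpow_mul (by positivity)]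
    have : (n : ℝ) / 4 * (2 : ℕ) = n / 2 := by push_cast; ring
    rw [this, ← Real.mul_rpow (by positivity) (by positivity)]
    have h4 : 1 / (Real.pi * ħ) * (4 * Real.pi * ħ) = 2 ^ (2 : ℝ) := by
      rw [Real.rpow_two]
      field_simp
      norm_num
    rw [h4, ← Real.rpow_mul (by norm_num), mul_div_cancel₀ _ two_ne_zero, Real.rpow_natCast,
      ← mul_pow]
    congr 1
    field_simp
  rw [h2, ← h3, hz]
  push_cast
  rw [mul_add, Complex.exp_add]
  have h5 : (-(Complex.I / ħ)) ^ 2 * (‖mom z‖ : ℂ) ^ 2 / (4 * (1 / (4 * ħ)))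
      = -(1 / ħ) * (‖mom z‖ : ℂ) ^ 2 := by
    rw [neg_sq, div_pow, Complex.I_sq]
    field_simp
  rw [h5]
  ring

theorem wavepacket_one_zero (n : ℕ) (ħ : ℝ) :
    wavepacket ħ (1 : Matrix (Fin n) (Fin n) ℝ) 0
      = {ψ : L2 n | ∃ γ : ℝ, ψ =ᵐ[volume] fun x =>
          Complex.exp (γ * Complex.I) * stdGaussian n ħ x} := by
  ext ψ
  refine exists_congr fun γ => ?_
  have h : ∀ x : Config n, Complex.exp (γ * Complex.I)
      * (((1 / (Real.pi * ħ)) ^ ((n : ℝ) / 4) : ℝ) : ℂ)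
      * (((1 : Matrix (Fin n) (Fin n) ℝ).det ^ (1 / 4 : ℝ) : ℝ) : ℂ)
      * Complex.exp (-(1 / (2 * ħ)) * (quad 1 x + Complex.I * quad 0 x))
      = Complex.exp (γ * Complex.I) * stdGaussian n ħ x := fun x => by
    rw [Matrix.det_one, Real.one_rpow, quad_one, quad_zero, stdGaussian]
    push_cast
    ring_nf
  simp_rw [h]

theorem wigner_phase_mul (ħ : ℝ) (ψ : Config n → ℂ) (γ : ℝ) (z : Phase n) :
    wigner ħ (fun x => Complex.exp (γ * Complex.I) * ψ x) z = wigner ħ ψ z := by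
  unfold wigner
  congr 2
  funext y
  rw [star_mul', star_exp_ofReal_mul_I]
  have h : ∀ a b c d e : ℂ, a * (b * c) * (d * e) = (b * d) * (a * c * e) := by intros; ring
  rw [h, ← Complex.exp_add, ← add_mul, ← Complex.ofReal_add, add_neg_cancel, Complex.ofReal_zero,
    zero_mul, Complex.exp_zero, one_mul]

theorem wavepacket_one_zero_eq_stateOf (n : ℕ) {ħ : ℝ} (hħ : 0 < ħ) :
    wavepacket ħ (1 : Matrix (Fin n) (Fin n) ℝ) 0 = stateOf ħ 1 := by
  rw [wavepacket_one_zero]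
  ext ψ
  constructor
  · rintro ⟨γ, hγ⟩ z
    rw [wigner_congr_ae hγ, wigner_phase_mul]
    exact wigner_stdGaussian n hħ z
  · intro h
    exact exists_phase_of_wigner_eq hħ (Lp.memLp ψ) (memLp_stdGaussian n hħ)
      (Lp.stronglyMeasurable ψ).measurable (measurable_stdGaussian n ħ) (stdGaussian_ne_zero n hħ)
      fun z => (h z).trans (wigner_stdGaussian n hħ z).symm

/-! ### The wavepackets `ψ_{AB}` as images of the standard Gaussian -/

section Sqrt

variable {A : Matrix (Fin n) (Fin n) ℝ}

theorem sqrt_mul_sqrt (hA : A.PosDef) : CFC.sqrt A * CFC.sqrt A = A :=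
  CFC.sqrt_mul_sqrt_self A hA.posSemidef.nonneg

theorem posSemidef_sqrt (A : Matrix (Fin n) (Fin n) ℝ) : (CFC.sqrt A).PosSemidef :=
  Matrix.nonneg_iff_posSemidef.1 (CFC.sqrt_nonneg A)

theorem transpose_sqrt (A : Matrix (Fin n) (Fin n) ℝ) : (CFC.sqrt A)ᵀ = CFC.sqrt A := by
  have h := (posSemidef_sqrt A).isHermitian
  rwa [Matrix.IsHermitian, Matrix.conjTranspose_eq_transpose_of_trivial] at h

theorem det_sqrt_pos (hA : A.PosDef) : 0 < (CFC.sqrt A).det := by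
  refine lt_of_le_of_ne (posSemidef_sqrt A).det_nonneg fun h => hA.det_pos.ne' ?_
  rw [← sqrt_mul_sqrt hA, Matrix.det_mul, ← h, zero_mul]

/-- The square root of a positive definite matrix, as an invertible matrix. -/
noncomputable def sqrtUnit (hA : A.PosDef) : GL (Fin n) ℝ :=
  Matrix.GeneralLinearGroup.mkOfDetNeZero (CFC.sqrt A) (det_sqrt_pos hA).ne'

theorem coe_sqrtUnit (hA : A.PosDef) : (sqrtUnit hA : Matrix (Fin n) (Fin n) ℝ) = CFC.sqrt A := rfl

theorem matS_eq_mul (A B : Matrix (Fin n) (Fin n) ℝ) :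
    matS A B = fromBlocks 1 0 (-B) 1 * fromBlocks (CFC.sqrt A)⁻¹ 0 0 (CFC.sqrt A)ᵀ := by
  rw [matS, Matrix.fromBlocks_multiply, transpose_sqrt]
  simp

theorem matS_mem (hA : A.PosDef) {B : Matrix (Fin n) (Fin n) ℝ} (hB : B.IsSymm) :
    matS A B ∈ Sp n := by
  rw [matS_eq_mul]
  exact mul_mem (lowerShear_mem hB.neg) (diagonal_mem (sqrtUnit hA))

theorem spMap_matS (hA : A.PosDef) {B : Matrix (Fin n) (Fin n) ℝ} (hB : B.IsSymm) :
    spMap n ⟨matS A B, matS_mem hA hB⟩ = spMap n ⟨_, lowerShear_mem hB.neg⟩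
      * spMap n ⟨_, diagonal_mem (sqrtUnit hA)⟩ := by
  rw [← map_mul]
  congr 1
  exact Subtype.ext (matS_eq_mul A B)

/-- The substitution `x ↦ √A x` turns `|x|²` into `Ax · x` with weight `√(det √A) = (det A)^{1/4}`,
and `V̂_B` supplies the imaginary part. The index `0` is admissible since `det √A > 0`. -/
theorem wavepacket_eq_image {ħ : ℝ} (hħ : 0 < ħ) (hA : A.PosDef) (B : Matrix (Fin n) (Fin n) ℝ) :
    wavepacket ħ A B = (opV ħ B * opM (sqrtUnit hA) 0) '' wavepacket ħ 1 0 := by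
  have key : ∀ (ψ : L2 n) (γ : ℝ),
      (ψ =ᵐ[volume] fun x => Complex.exp (γ * Complex.I) * stdGaussian n ħ x) →
      (opV ħ B * opM (sqrtUnit hA) 0) ψ =ᵐ[volume] fun x =>
        Complex.exp (γ * Complex.I) * (((1 / (Real.pi * ħ)) ^ ((n : ℝ) / 4) : ℝ) : ℂ)
        * ((A.det ^ (1 / 4 : ℝ) : ℝ) : ℂ)
        * Complex.exp (-(1 / (2 * ħ)) * (quad A x + Complex.I * quad B x)) := by
    intro ψ γ h
    filter_upwards [opV_apply ħ B (opM (sqrtUnit hA) 0 ψ), opM_apply (sqrtUnit hA) 0 ψ,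
      ae_comp_of_map (map_linEquiv (sqrtUnit hA)) h] with x h1 h2 h3
    have h3' : ψ (lin (sqrtUnit hA : Matrix (Fin n) (Fin n) ℝ) x) = _ := h3
    rw [unitaryOp_mul_apply, h1, h2, h3', zpow_zero, one_mul, coe_sqrtUnit]
    have h4 : √|(CFC.sqrt A).det| = A.det ^ (1 / 4 : ℝ) := by
      rw [abs_of_pos (det_sqrt_pos hA)]
      have h5 : A.det = (CFC.sqrt A).det ^ (2 : ℝ) := by
        conv_lhs => rw [← sqrt_mul_sqrt hA, Matrix.det_mul]
        rw [Real.rpow_two, sq]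
      rw [h5, ← Real.rpow_mul (det_sqrt_pos hA).le, Real.sqrt_eq_rpow]
      norm_num
    have h6 : ‖linEquiv (sqrtUnit hA) x‖ ^ 2 = quad A x := by
      rw [← quad_one]
      refine (quad_lin 1 (CFC.sqrt A) x).trans ?_
      rw [Matrix.mul_one, transpose_sqrt, sqrt_mul_sqrt hA]
    have h6' := congrArg (fun t : ℝ => (t : ℂ)) h6
    push_cast at h6'
    rw [h4, stdGaussian, h6', mul_add, Complex.exp_add]
    have h7 : Complex.exp (((-(1 / (2 * ħ)) * quad B x : ℝ) : ℂ) * Complex.I)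
        = Complex.exp (-(1 / (2 * ħ)) * (Complex.I * quad B x)) := by
      congr 1
      push_cast
      ring
    rw [h7]
    ring
  rw [wavepacket_one_zero]
  ext φ
  constructor
  · rintro ⟨γ, hγ⟩
    have hm := (memLp_stdGaussian n hħ).const_mul (Complex.exp (γ * Complex.I))
    refine ⟨hm.toLp, ⟨γ, hm.coeFn_toLp⟩, ?_⟩
    ext1
    exact (key _ γ hm.coeFn_toLp).trans hγ.symm
  · rintro ⟨ψ, ⟨γ, hγ⟩, rfl⟩
    exact ⟨γ, key ψ γ hγ⟩

theorem wavepacket_eq_stateOf {ħ : ℝ} (hħ : 0 < ħ) (hA : A.PosDef)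
    {B : Matrix (Fin n) (Fin n) ℝ} (hB : B.IsSymm) :
    wavepacket ħ A B = stateOf ħ (spMap n ⟨matS A B, matS_mem hA hB⟩) := by
  rw [wavepacket_eq_image hħ hA, wavepacket_one_zero_eq_stateOf n hħ,
    ((wignerCovariant_opV ħ hB).mul (wignerCovariant_opM ħ (sqrtUnit hA) 0)).image_stateOf,
    spMap_matS hA hB, mul_one]

theorem gaussState_eq_stateOf {ħ : ℝ} (hħ : 0 < ħ) (z₀ : Phase n) (hA : A.PosDef)
    {B : Matrix (Fin n) (Fin n) ℝ} (hB : B.IsSymm) :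
    gaussState ħ z₀ A B = stateOf ħ (translation z₀ * spMap n ⟨matS A B, matS_mem hA hB⟩) := by
  rw [gaussState, wavepacket_eq_stateOf hħ hA hB,
    (wignerCovariant_heisenberg ħ z₀).image_stateOf]

end Sqrt

/-! ### Factorizations of symplectic matrices -/

theorem posDef_mul_transpose {S : Matrix (Fin n ⊕ Fin n) (Fin n ⊕ Fin n) ℝ} (hS : S ∈ Sp n) :
    (S * Sᵀ).PosDef := by
  have h := Matrix.PosDef.mul_conjTranspose_self S
    (Matrix.vecMul_injective_iff_isUnit.2
      ((Matrix.isUnit_iff_isUnit_det _).2 (SymplecticGroup.symplectic_det hS)))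
  rwa [Matrix.conjTranspose_eq_transpose_of_trivial] at h

theorem matS_mul_transpose {A B : Matrix (Fin n) (Fin n) ℝ} (hA : A.PosDef) (hB : B.IsSymm) :
    matS A B * (matS A B)ᵀ = fromBlocks A⁻¹ (-(A⁻¹ * B)) (-(B * A⁻¹)) (B * A⁻¹ * B + A) := by
  have h1 : (CFC.sqrt A)⁻¹ * (CFC.sqrt A)⁻¹ = A⁻¹ := by
    rw [← Matrix.mul_inv_rev, sqrt_mul_sqrt hA]
  have h2 : ((CFC.sqrt A)⁻¹)ᵀ = (CFC.sqrt A)⁻¹ := by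
    rw [Matrix.transpose_nonsing_inv, transpose_sqrt]
  rw [matS, Matrix.fromBlocks_transpose, Matrix.fromBlocks_multiply]
  simp only [h2, transpose_sqrt, Matrix.transpose_neg, Matrix.transpose_mul, hB.eq,
    Matrix.transpose_zero, Matrix.mul_zero, Matrix.zero_mul, add_zero, Matrix.mul_neg,
    Matrix.neg_mul, neg_neg, sqrt_mul_sqrt hA]
  congr 1
  · rw [← Matrix.mul_assoc, h1]
  · rw [Matrix.mul_assoc, h1]
  · rw [Matrix.mul_assoc, ← Matrix.mul_assoc _ _ B, h1, Matrix.mul_assoc]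

/-- The left blocks `X`, `Y'` of `N = S Sᵀ` force `A = X⁻¹` and `B = -Y' X⁻¹`. Since `N` is itself
symplectic, its block relations make `B` symmetric and determine the remaining block. -/
theorem exists_matS_mul_transpose_eq {S : Matrix (Fin n ⊕ Fin n) (Fin n ⊕ Fin n) ℝ}
    (hS : S ∈ Sp n) : ∃ A B : Matrix (Fin n) (Fin n) ℝ, A.PosDef ∧ B.IsSymm ∧
      S * Sᵀ = matS A B * (matS A B)ᵀ := by
  have hN : S * Sᵀ ∈ Sp n := mul_mem hS (SymplecticGroup.transpose_mem hS)
  have hpos := posDef_mul_transpose hS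
  have hsymm : (S * Sᵀ)ᵀ = S * Sᵀ := by simp
  generalize S * Sᵀ = N at hN hpos hsymm
  obtain ⟨X, Y, Y', Z, rfl⟩ : ∃ X Y Y' Z, N = fromBlocks X Y Y' Z :=
    ⟨_, _, _, _, (Matrix.fromBlocks_toBlocks N).symm⟩
  have hX : X.PosDef := by
    have h := hpos.submatrix (e := (Sum.inl : Fin n → Fin n ⊕ Fin n)) Sum.inl_injective
    exact h
  rw [Matrix.fromBlocks_transpose, Matrix.fromBlocks_inj] at hsymm
  obtain ⟨hX', rfl, -, hZ⟩ := hsymm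
  rw [SymplecticGroup.fromBlocks_mem_iff, hX', hZ, Matrix.transpose_transpose] at hN
  obtain ⟨h1, -, h3⟩ := hN
  have hXu : IsUnit X.det := (Matrix.isUnit_iff_isUnit_det _).1 hX.isUnit
  have h3' : Z * X = 1 + Y' * Y' := by
    have h := congrArg Matrix.transpose h3
    simp only [Matrix.transpose_sub, Matrix.transpose_mul, hX', hZ, Matrix.transpose_one,
      Matrix.transpose_transpose] at h
    rw [← h]
    abel
  have h4 : X⁻¹ * Y'ᵀ = Y' * X⁻¹ := by
    have h : X⁻¹ * (X * Y') * X⁻¹ = X⁻¹ * (Y'ᵀ * X) * X⁻¹ := by rw [h1]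
    rwa [Matrix.nonsing_inv_mul_cancel_left _ _ hXu, Matrix.mul_assoc, Matrix.mul_assoc,
      Matrix.mul_nonsing_inv _ hXu, Matrix.mul_one, eq_comm] at h
  have hB : (-(Y' * X⁻¹)).IsSymm := by
    rw [Matrix.IsSymm, Matrix.transpose_neg, Matrix.transpose_mul, Matrix.transpose_nonsing_inv,
      hX', h4]
  refine ⟨X⁻¹, -(Y' * X⁻¹), hX.inv, hB, ?_⟩
  rw [matS_mul_transpose hX.inv hB, Matrix.nonsing_inv_nonsing_inv _ hXu]
  simp only [Matrix.mul_neg, Matrix.neg_mul, neg_neg]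
  rw [Matrix.nonsing_inv_mul_cancel_right _ _ hXu]
  congr 1
  · rw [← h4, Matrix.mul_nonsing_inv_cancel_left _ _ hXu]
  · have h : Z * X * X⁻¹ = (1 + Y' * Y') * X⁻¹ := by rw [h3']
    rw [Matrix.mul_nonsing_inv_cancel_right _ _ hXu] at h
    rw [h, add_mul, one_mul, add_comm, Matrix.mul_assoc]

/-- Every symplectic matrix is the product of some `S_{AB}` and an orthogonal symplectic matrix. -/
theorem exists_eq_matS_mul_orthogonal (S : Sp n) :
    ∃ (A B : Matrix (Fin n) (Fin n) ℝ) (hA : A.PosDef) (hB : B.IsSymm) (O : Sp n),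
      S = ⟨matS A B, matS_mem hA hB⟩ * O ∧
      (O : Matrix (Fin n ⊕ Fin n) (Fin n ⊕ Fin n) ℝ)ᵀ * O = 1 := by
  obtain ⟨A, B, hA, hB, h⟩ := exists_matS_mul_transpose_eq S.2
  have hu := SymplecticGroup.symplectic_det (matS_mem hA hB)
  let T : Sp n := ⟨matS A B, matS_mem hA hB⟩
  have hO : ((T⁻¹ * S : Sp n) : Matrix (Fin n ⊕ Fin n) (Fin n ⊕ Fin n) ℝ) = (matS A B)⁻¹ * S := by
    rw [Submonoid.coe_mul, SymplecticGroup.coe_inv']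
  refine ⟨A, B, hA, hB, T⁻¹ * S, (mul_inv_cancel_left T S).symm, ?_⟩
  rw [hO]
  -- `O Oᵀ = 1` is what `S Sᵀ = S_{AB} S_{AB}ᵀ` gives directly; for square matrices the order is
  -- immaterial.
  refine mul_eq_one_comm.1 ?_
  rw [Matrix.transpose_mul, Matrix.mul_assoc, ← Matrix.mul_assoc _ _ ((matS A B)⁻¹)ᵀ, h,
    Matrix.mul_assoc, ← Matrix.transpose_mul, Matrix.nonsing_inv_mul _ hu, Matrix.transpose_one,
    Matrix.mul_one, Matrix.nonsing_inv_mul _ hu]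

theorem norm_lin_of_orthogonal {ι : Type*} [Fintype ι] [DecidableEq ι] {O : Matrix ι ι ℝ}
    (hO : Oᵀ * O = 1) (z : EuclideanSpace ℝ ι) : ‖lin O z‖ = ‖z‖ := by
  have h : ‖lin O z‖ ^ 2 = ‖z‖ ^ 2 := by
    rw [← quad_one, quad_lin, Matrix.mul_one, hO, quad_one]
  exact (sq_eq_sq₀ (norm_nonneg _) (norm_nonneg _)).1 h

/-! ### Generators of the symplectic group -/

/-- If `a`, `c` are the left blocks of a symplectic matrix, then `a + s c` is invertible for some
real `s`. -/
theorem exists_isUnit_det_add_smul {a b c d : Matrix (Fin n) (Fin n) ℝ}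
    (h : fromBlocks a b c d ∈ Sp n) : ∃ s : ℝ, IsUnit (a + s • c).det := by
  have hac : aᵀ * c = cᵀ * a := (SymplecticGroup.fromBlocks_mem_iff.1 h).1
  have hpos : (aᵀ * a + cᵀ * c).PosDef := by
    have h1 := (posDef_mul_transpose (SymplecticGroup.transpose_mem h)).submatrix
      (e := (Sum.inl : Fin n → Fin n ⊕ Fin n)) Sum.inl_injective
    rw [Matrix.transpose_transpose, Matrix.fromBlocks_transpose, Matrix.fromBlocks_multiply] at h1
    exact h1
  set p : Polynomial ℝ := (a.map Polynomial.C +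
    (Polynomial.X : Polynomial ℝ) • c.map Polynomial.C).det with hp
  have heval : ∀ s : ℝ, p.eval s = (a + s • c).det := fun s => by
    rw [hp, ← Polynomial.coe_evalRingHom, RingHom.map_det]
    congr 1
    ext i j
    simp only [Matrix.add_apply, Matrix.smul_apply, Matrix.map_apply, RingHom.mapMatrix_apply,
      smul_eq_mul, map_add, Polynomial.eval_mul, Polynomial.coe_evalRingHom, Polynomial.eval_C,
      Polynomial.eval_X]
  have haeval : Polynomial.aeval Complex.I p
      = (a.map Complex.ofRealHom + Complex.I • c.map Complex.ofRealHom).det := by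
    rw [hp, AlgHom.map_det]
    congr 1
    ext i j
    simp only [Matrix.add_apply, Matrix.smul_apply, Matrix.map_apply, AlgHom.mapMatrix_apply,
      smul_eq_mul, map_add, map_mul, Polynomial.aeval_C, Polynomial.aeval_X]
    rfl
  -- The polynomial `det(a + s c)` does not vanish at `s = i`: as `aᵀc` is symmetric, `(aᵀ - i cᵀ)(a
  -- + i c) = aᵀa + cᵀc`, which is positive definite. A nonzero real polynomial is nonzero at some
  -- real `s`.
  have hp0 : p ≠ 0 := fun h0 => by
    rw [h0, map_zero] at haeval
    set M := a.map Complex.ofRealHom + Complex.I • c.map Complex.ofRealHom with hM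
    have hMM : (aᵀ.map Complex.ofRealHom - Complex.I • cᵀ.map Complex.ofRealHom) * M
        = (aᵀ * a + cᵀ * c).map Complex.ofRealHom := by
      rw [hM, Matrix.map_add _ (map_add _), Matrix.map_mul, Matrix.map_mul]
      have hac' := congrArg (fun N => N.map Complex.ofRealHom) hac
      simp only [Matrix.map_mul] at hac'
      rw [sub_mul, mul_add, mul_add, Matrix.mul_smul, Matrix.smul_mul, Matrix.smul_mul,
        Matrix.mul_smul, hac', smul_smul, Complex.I_mul_I, neg_one_smul]
      abel
    have h1 := congrArg Matrix.det hMM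
    rw [Matrix.det_mul, ← haeval, mul_zero, ← RingHom.mapMatrix_apply, ← RingHom.map_det] at h1
    exact hpos.det_pos.ne' (Complex.ofReal_injective (h1.symm.trans Complex.ofReal_zero.symm))
  by_contra! hs
  refine hp0 (Polynomial.funext fun s => ?_)
  rw [heval, Polynomial.eval_zero]
  by_contra h0
  exact hs s (isUnit_iff_ne_zero.2 h0)

theorem upperShear_mem {P : Matrix (Fin n) (Fin n) ℝ} (hP : P.IsSymm) :
    (fromBlocks 1 P 0 1 : Matrix (Fin n ⊕ Fin n) (Fin n ⊕ Fin n) ℝ) ∈ Sp n := by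
  rw [SymplecticGroup.fromBlocks_mem_iff]
  simp [hP.eq]

/-- The symplectic group is generated by the quarter turn, the lower shears and the block diagonal
matrices. -/
theorem subgroup_eq_top {H : Subgroup (Sp n)} (hJ : ⟨_, quarterTurn_mem⟩ ∈ H)
    (hV : ∀ (P : Matrix (Fin n) (Fin n) ℝ) (hP : P.IsSymm), ⟨_, lowerShear_mem hP⟩ ∈ H)
    (hM : ∀ L : GL (Fin n) ℝ, ⟨_, diagonal_mem L⟩ ∈ H) : H = ⊤ := by
  have hU : ∀ (P : Matrix (Fin n) (Fin n) ℝ) (hP : P.IsSymm),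
      (⟨_, upperShear_mem hP⟩ : Sp n) ∈ H := by
    intro P hP
    -- Conjugation by the quarter turn exchanges lower and upper shears.
    have h : (⟨_, upperShear_mem hP⟩ : Sp n) * ⟨_, quarterTurn_mem⟩
        = ⟨_, quarterTurn_mem⟩ * ⟨_, lowerShear_mem hP.neg⟩ := by
      apply Subtype.ext
      simp [Matrix.fromBlocks_multiply]
    rw [eq_mul_inv_of_mul_eq h]
    exact mul_mem (mul_mem hJ (hV _ hP.neg)) (inv_mem hJ)
  have hblock : ∀ (a b c d : Matrix (Fin n) (Fin n) ℝ) (h : fromBlocks a b c d ∈ Sp n),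
      IsUnit a.det → (⟨_, h⟩ : Sp n) ∈ H := by
    intro a b c d h ha
    obtain ⟨h1, -, h3⟩ := SymplecticGroup.fromBlocks_mem_iff.1 h
    have h4 : a * bᵀ = b * aᵀ := by
      have h' := SymplecticGroup.transpose_mem h
      rw [Matrix.fromBlocks_transpose] at h'
      simpa using (SymplecticGroup.fromBlocks_mem_iff.1 h').1
    have ha' : IsUnit aᵀ.det := by rwa [Matrix.det_transpose]
    have hc : (c * a⁻¹)ᵀ = c * a⁻¹ := by
      rw [Matrix.transpose_mul, Matrix.transpose_nonsing_inv]
      have h5 : aᵀ⁻¹ * (aᵀ * c) * a⁻¹ = aᵀ⁻¹ * (cᵀ * a) * a⁻¹ := by rw [h1]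
      rw [Matrix.nonsing_inv_mul_cancel_left _ _ ha', Matrix.mul_assoc, Matrix.mul_assoc,
        Matrix.mul_nonsing_inv _ ha, Matrix.mul_one] at h5
      exact h5.symm
    have hb : (a⁻¹ * b)ᵀ = a⁻¹ * b := by
      rw [Matrix.transpose_mul, Matrix.transpose_nonsing_inv]
      have h5 : a⁻¹ * (a * bᵀ) * aᵀ⁻¹ = a⁻¹ * (b * aᵀ) * aᵀ⁻¹ := by rw [h4]
      rwa [Matrix.nonsing_inv_mul_cancel_left _ _ ha, Matrix.mul_assoc, Matrix.mul_assoc,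
        Matrix.mul_nonsing_inv _ ha', Matrix.mul_one] at h5
    set L : GL (Fin n) ℝ := (Matrix.nonsingInvUnit a ha)⁻¹ with hL
    have hL1 : (L : Matrix (Fin n) (Fin n) ℝ) = a⁻¹ := rfl
    -- Block LDU factorization, available because `a` is invertible. The symplectic relations make
    -- both shears symmetric and identify the Schur complement `d - c a⁻¹ b` with `(aᵀ)⁻¹`.
    have hprod : (⟨_, h⟩ : Sp n) = ⟨_, lowerShear_mem (P := c * a⁻¹) hc⟩ *
        ⟨_, diagonal_mem L⟩ * ⟨_, upperShear_mem (P := a⁻¹ * b) hb⟩ := by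
      apply Subtype.ext
      simp only [Submonoid.coe_mul, Matrix.fromBlocks_multiply, hL1,
        Matrix.nonsing_inv_nonsing_inv _ ha, Matrix.one_mul, Matrix.mul_one, Matrix.mul_zero,
        Matrix.zero_mul, add_zero, zero_add]
      congr 1
      · rw [Matrix.mul_nonsing_inv_cancel_left _ _ ha]
      · rw [Matrix.nonsing_inv_mul_cancel_right _ _ ha]
      · rw [Matrix.nonsing_inv_mul_cancel_right _ _ ha, ← Matrix.mul_assoc, ← hc,
          Matrix.transpose_mul, Matrix.transpose_nonsing_inv]
        have h5 : aᵀ * d = 1 + cᵀ * b := by rw [← h3]; abel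
        have h6 := congrArg (fun N => aᵀ⁻¹ * N) h5
        beta_reduce at h6
        rw [Matrix.nonsing_inv_mul_cancel_left _ _ ha', Matrix.mul_add, Matrix.mul_one] at h6
        rw [h6, add_comm, Matrix.mul_assoc]
    rw [hprod]
    exact mul_mem (mul_mem (hV _ hc) (hM _)) (hU _ hb)
  rw [eq_top_iff]
  rintro ⟨S, hS⟩ -
  obtain ⟨a, b, c, d, rfl⟩ : ∃ a b c d, S = fromBlocks a b c d :=
    ⟨_, _, _, _, (Matrix.fromBlocks_toBlocks S).symm⟩
  -- An upper shear by `s • 1` replaces `a` by `a + s c`, reducing to an invertible upper left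
  -- block.
  obtain ⟨s, hs⟩ := exists_isUnit_det_add_smul hS
  have hsymm : (s • (1 : Matrix (Fin n) (Fin n) ℝ)).IsSymm := Matrix.isSymm_one.smul s
  have hmul : (fromBlocks 1 (s • 1) 0 1 : Matrix (Fin n ⊕ Fin n) (Fin n ⊕ Fin n) ℝ)
      * fromBlocks a b c d = fromBlocks (a + s • c) (b + s • d) c d := by
    simp [Matrix.fromBlocks_multiply]
  have hmem := mul_mem (upperShear_mem hsymm) hS
  rw [hmul] at hmem
  have h1 := hblock _ _ _ _ hmem hs
  have h2 : (⟨_, hmem⟩ : Sp n) = ⟨_, upperShear_mem hsymm⟩ * ⟨_, hS⟩ := Subtype.ext hmul.symm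
  rw [h2] at h1
  exact (H.mul_mem_cancel_left (hU _ hsymm)).1 h1

end QuantumBlob

namespace QuantumBlob

variable {n : ℕ} {ħ : ℝ}

/-! ### States and blobs as orbits -/

theorem spMap_mem (S : Sp n) : spMap n S ∈ ISp n :=
  ⟨S, 0, by ext1 z; simp [translation]⟩

theorem translation_mem (z₀ : Phase n) : translation z₀ ∈ ISp n :=
  ⟨1, z₀, by rw [map_one, one_mul]⟩

theorem exists_eq_translation_mul {f : Equiv.Perm (Phase n)} (hf : f ∈ ISp n) :
    ∃ (z₀ : Phase n) (S : Sp n), f = translation z₀ * spMap n S := by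
  obtain ⟨S, z₀, rfl⟩ := hf
  exact ⟨_, S, translation_mul_spMap S z₀⟩

/-- The model Wigner transform is radial, so norm-preserving maps on the right are invisible. -/
theorem stateOf_mul_of_norm (f : Equiv.Perm (Phase n)) {g : Equiv.Perm (Phase n)}
    (hg : ∀ z, ‖g z‖ = ‖z‖) : stateOf ħ (f * g) = stateOf ħ f := by
  ext ψ
  constructor
  · intro h z
    have h1 := h (g.symm z)
    rwa [← hg (g.symm z), Equiv.Perm.mul_apply, g.apply_symm_apply] at h1
  · intro h z
    rw [← hg z]
    exact h (g z)

theorem exists_spMap_eq (S : Sp n) : ∃ (A B : Matrix (Fin n) (Fin n) ℝ) (hA : A.PosDef)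
    (hB : B.IsSymm) (g : Equiv.Perm (Phase n)), (∀ z, ‖g z‖ = ‖z‖) ∧
      spMap n S = spMap n ⟨matS A B, matS_mem hA hB⟩ * g := by
  obtain ⟨A, B, hA, hB, O, hS, hO⟩ := exists_eq_matS_mul_orthogonal S
  exact ⟨A, B, hA, hB, spMap n O, norm_lin_of_orthogonal hO, by rw [← map_mul, ← hS]⟩

theorem mem_Gauss₀_iff (hħ : 0 < ħ) {s : Set (L2 n)} :
    s ∈ Gauss₀ n ħ ↔ ∃ S : Sp n, s = stateOf ħ (spMap n S) := by
  constructor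
  · rintro ⟨A, B, hA, hB, rfl⟩
    exact ⟨_, wavepacket_eq_stateOf hħ hA hB⟩
  · rintro ⟨S, rfl⟩
    obtain ⟨A, B, hA, hB, g, hg, h⟩ := exists_spMap_eq S
    exact ⟨A, B, hA, hB, by rw [h, stateOf_mul_of_norm _ hg, wavepacket_eq_stateOf hħ hA hB]⟩

theorem mem_Gauss_iff (hħ : 0 < ħ) {s : Set (L2 n)} :
    s ∈ Gauss n ħ ↔ ∃ f ∈ ISp n, s = stateOf ħ f := by
  constructor
  · rintro ⟨z₀, A, B, hA, hB, rfl⟩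
    exact ⟨_, mul_mem (translation_mem z₀) (spMap_mem _), gaussState_eq_stateOf hħ z₀ hA hB⟩
  · rintro ⟨f, hf, rfl⟩
    obtain ⟨z₀, S, rfl⟩ := exists_eq_translation_mul hf
    obtain ⟨A, B, hA, hB, g, hg, h⟩ := exists_spMap_eq S
    exact ⟨z₀, A, B, hA, hB,
      by rw [h, ← mul_assoc, stateOf_mul_of_norm _ hg, gaussState_eq_stateOf hħ z₀ hA hB]⟩

theorem mem_QB_iff {Q : Set (Phase n)} :
    Q ∈ QB n ħ ↔ ∃ f ∈ ISp n, Q = f '' Metric.closedBall 0 √ħ := by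
  have h : ∀ z₀ : Phase n,
      translation z₀ '' Metric.closedBall 0 √ħ = Metric.closedBall z₀ √ħ := fun z₀ => by
    ext z
    rw [Equiv.image_eq_preimage_symm, Set.mem_preimage, mem_closedBall_zero_iff,
      mem_closedBall_iff_norm]
    rfl
  constructor
  · rintro ⟨S, z₀, rfl⟩
    exact ⟨_, ⟨S, z₀, rfl⟩, by rw [Equiv.Perm.coe_mul, Set.image_comp, h]⟩
  · rintro ⟨_, ⟨S, z₀, rfl⟩, rfl⟩
    exact ⟨S, z₀, by rw [Equiv.Perm.coe_mul, Set.image_comp, h]⟩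

/-- A prescribed Wigner transform need not be attained by any function; here a solution comes from
an explicit Gaussian moved by unitaries. -/
theorem stateOf_nonempty (hħ : 0 < ħ) {f : Equiv.Perm (Phase n)} (hf : f ∈ ISp n) :
    (stateOf ħ f).Nonempty := by
  obtain ⟨z₀, A, B, hA, hB, h⟩ := (mem_Gauss_iff hħ).2 ⟨f, hf, rfl⟩
  have h1 : (wavepacket ħ (1 : Matrix (Fin n) (Fin n) ℝ) 0).Nonempty := by
    rw [wavepacket_one_zero]
    have hm := (memLp_stdGaussian n hħ).const_mul (Complex.exp ((0 : ℝ) * Complex.I))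
    exact ⟨hm.toLp, 0, hm.coeFn_toLp⟩
  rw [h, gaussState, wavepacket_eq_image hħ hA]
  exact (h1.image _).image _

/-! ### The quantum blob of a state -/

/-- The set where the Wigner transform of a state is at least `e⁻¹` times the maximal value
`(πħ)⁻ⁿ` of a Gaussian one. -/
noncomputable def blob (ħ : ℝ) (s : Set (L2 n)) : Set (Phase n) :=
  {z | ∃ ψ ∈ s, (1 / (Real.pi * ħ)) ^ n * Real.exp (-1) ≤ (wigner ħ ψ z).re}

theorem WignerCovariant.blob_image {U : UnitaryOp n} {f : Equiv.Perm (Phase n)}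
    (hU : WignerCovariant ħ U f) (s : Set (L2 n)) : blob ħ (U '' s) = f '' blob ħ s := by
  ext z
  rw [Equiv.image_eq_preimage_symm, Set.mem_preimage]
  have h : ∀ ψ : L2 n, wigner ħ (U ψ) z = wigner ħ ψ (f.symm z) := fun ψ => by
    rw [← hU ψ (f.symm z), f.apply_symm_apply]
  constructor
  · rintro ⟨_, ⟨ψ, hψ, rfl⟩, hz⟩
    exact ⟨ψ, hψ, by rwa [← h]⟩
  · rintro ⟨ψ, hψ, hz⟩
    exact ⟨U ψ, ⟨ψ, hψ, rfl⟩, by rwa [h]⟩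

/-- The factor `e⁻¹` is the value of `exp(-|z|²/ħ)` on the sphere `|z|² = ħ`. -/
theorem blob_stateOf (hħ : 0 < ħ) {f : Equiv.Perm (Phase n)} (hf : f ∈ ISp n) :
    blob ħ (stateOf ħ f) = f '' Metric.closedBall 0 √ħ := by
  have hpi := Real.pi_pos
  have hc : 0 < (1 / (Real.pi * ħ)) ^ n := by positivity
  have key : ∀ z : Phase n, (1 / (Real.pi * ħ)) ^ n * Real.exp (-1)
      ≤ (1 / (Real.pi * ħ)) ^ n * Real.exp (-(1 / ħ) * ‖z‖ ^ 2) ↔ ‖z‖ ≤ √ħ := fun z => by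
    rw [mul_le_mul_iff_of_pos_left hc, Real.exp_le_exp, Real.le_sqrt (norm_nonneg _) hħ.le,
      neg_mul, neg_le_neg_iff, one_div, inv_mul_le_iff₀ hħ, mul_one]
  have hW : ∀ ψ ∈ stateOf ħ f, ∀ z, (wigner ħ ψ z).re
      = (1 / (Real.pi * ħ)) ^ n * Real.exp (-(1 / ħ) * ‖f.symm z‖ ^ 2) := fun ψ hψ z => by
    have h := hψ (f.symm z)
    rw [f.apply_symm_apply] at h
    rw [h, Complex.ofReal_re]
  ext z
  rw [Equiv.image_eq_preimage_symm, Set.mem_preimage, mem_closedBall_zero_iff, ← key]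
  constructor
  · rintro ⟨ψ, hψ, hz⟩
    rwa [← hW ψ hψ]
  · intro hz
    obtain ⟨ψ, hψ⟩ := stateOf_nonempty hħ hf
    exact ⟨ψ, hψ, by rwa [hW ψ hψ]⟩

theorem norm_le_of_ball {S : Sp n} {r : ℝ} (hr : 0 < r)
    (h : ∀ z : Phase n, ‖z‖ ≤ r → ‖spMap n S z‖ ≤ r) (z : Phase n) : ‖spMap n S z‖ ≤ ‖z‖ := by
  rcases eq_or_ne z 0 with rfl | hz
  · have : spMap n S 0 = 0 := by
      change lin _ 0 = 0
      simp [lin]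
    rw [this]
  · have hz' : 0 < ‖z‖ := norm_pos_iff.2 hz
    have h1 := h ((r / ‖z‖) • z) (by
      rw [norm_smul, Real.norm_of_nonneg (by positivity), div_mul_cancel₀ _ hz'.ne'])
    have h2 : spMap n S ((r / ‖z‖) • z) = (r / ‖z‖) • spMap n S z := lin_smul _ _ _
    rw [h2, norm_smul, Real.norm_of_nonneg (by positivity), div_mul_eq_mul_div,
      div_le_iff₀ hz'] at h1
    exact le_of_mul_le_mul_left h1 hr

/-- Apply the bound to `z` and `-z` and average: the cross terms cancel. -/
theorem norm_sq_add_norm_sq_le {S : Sp n} {w : Phase n} {r : ℝ}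
    (h : ∀ z : Phase n, ‖z‖ ≤ r → ‖spMap n S z + w‖ ≤ r) {z : Phase n} (hz : ‖z‖ ≤ r) :
    ‖spMap n S z‖ ^ 2 + ‖w‖ ^ 2 ≤ r ^ 2 := by
  have h1 := h z hz
  have h2 := h (-z) (by rwa [norm_neg])
  have h3 : spMap n S (-z) = -spMap n S z := by
    rw [← neg_one_smul ℝ z, ← neg_one_smul ℝ (spMap n S z)]
    exact lin_smul _ _ _
  rw [h3] at h2
  have h4 : -spMap n S z + w = -(spMap n S z - w) := by abel
  rw [h4, norm_neg] at h2
  have h5 := norm_add_sq_real (spMap n S z) w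
  have h6 := norm_sub_sq_real (spMap n S z) w
  have h7 := pow_le_pow_left₀ (norm_nonneg _) h1 2
  have h8 := pow_le_pow_left₀ (norm_nonneg _) h2 2
  linarith

/-- An affine symplectic transformation preserving a ball about the origin preserves the norm. -/
theorem norm_apply_of_image_closedBall {f : Equiv.Perm (Phase n)} (hf : f ∈ ISp n) {r : ℝ}
    (hr : 0 < r) (h : f '' Metric.closedBall 0 r = Metric.closedBall 0 r) (z : Phase n) :
    ‖f z‖ = ‖z‖ := by
  have hball : ∀ {g : Equiv.Perm (Phase n)}, g '' Metric.closedBall 0 r = Metric.closedBall 0 r →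
      ∀ z : Phase n, ‖z‖ ≤ r → ‖g z‖ ≤ r := fun {g} hg z hz => by
    rw [← mem_closedBall_zero_iff, ← hg]
    exact ⟨z, mem_closedBall_zero_iff.2 hz, rfl⟩
  have hcontr : ∀ {w : Phase n} {S : Sp n},
      (∀ z : Phase n, ‖z‖ ≤ r → ‖spMap n S z + w‖ ≤ r) → ∀ z, ‖spMap n S z‖ ≤ ‖z‖ :=
    fun {w S} hS => norm_le_of_ball hr fun z hz => by
      have h1 := norm_sq_add_norm_sq_le hS hz
      exact le_of_sq_le_sq (by nlinarith [sq_nonneg ‖w‖]) hr.le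
  obtain ⟨w, S, rfl⟩ := exists_eq_translation_mul hf
  -- The inverse map `u ↦ S⁻¹u - S⁻¹w` also preserves the ball, so both `S` and `S⁻¹` are
  -- contractions and `S` is isometric.
  have hinv : ∀ u : Phase n, ‖u‖ ≤ r → ‖spMap n S⁻¹ u + spMap n S⁻¹ (-w)‖ ≤ r := fun u hu => by
    have h1 : u ∈ (translation w * spMap n S) '' Metric.closedBall 0 r := by
      rwa [h, mem_closedBall_zero_iff]
    obtain ⟨z, hz, rfl⟩ := h1
    have h2 : spMap n S⁻¹ ((translation w * spMap n S) z) + spMap n S⁻¹ (-w) = z := by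
      refine (lin_add _ _ _).symm.trans ?_
      have h3 : (translation w * spMap n S) z + -w = spMap n S z := add_neg_cancel_right _ _
      rw [h3]
      exact (spMap n S).symm_apply_apply z
    rw [h2]
    exact mem_closedBall_zero_iff.1 hz
  have hS := hball h
  have h1 : ∀ z, ‖spMap n S z‖ ≤ ‖z‖ := hcontr hS
  have h2 : ∀ z, ‖spMap n S⁻¹ z‖ ≤ ‖z‖ := hcontr hinv
  have h3 : ∀ z, ‖spMap n S z‖ = ‖z‖ := fun z => by
    refine le_antisymm (h1 z) ?_
    have h4 := h2 (spMap n S z)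
    rw [map_inv] at h4
    have h5 : (spMap n S)⁻¹ (spMap n S z) = z := (spMap n S).symm_apply_apply z
    rwa [h5] at h4
  have hw : w = 0 := by
    by_contra hw
    have hw' : 0 < ‖w‖ := norm_pos_iff.2 hw
    have h4 : ‖(r / ‖w‖) • w‖ = r := by
      rw [norm_smul, Real.norm_of_nonneg (by positivity), div_mul_cancel₀ _ hw'.ne']
    -- A point on the bounding sphere gives `r² + |w|² ≤ r²`.
    have h5 := norm_sq_add_norm_sq_le (w := w) hS h4.le
    rw [h3, h4] at h5
    nlinarith
  rw [hw]
  refine Eq.trans ?_ (h3 z)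
  congr 1
  exact add_zero _

/-- States with the same blob are equal. -/
theorem stateOf_eq_of_image_closedBall_eq (hħ : 0 < ħ) {f g : Equiv.Perm (Phase n)}
    (hf : f ∈ ISp n) (hg : g ∈ ISp n)
    (h : f '' Metric.closedBall 0 √ħ = g '' Metric.closedBall 0 √ħ) :
    stateOf ħ f = stateOf ħ g := by
  have h1 : (g⁻¹ * f) '' Metric.closedBall 0 √ħ = Metric.closedBall 0 √ħ := by
    rw [Equiv.Perm.coe_mul, Set.image_comp, h, ← Set.image_comp, ← Equiv.Perm.coe_mul,
      inv_mul_cancel, Equiv.Perm.coe_one, Set.image_id]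
  have h2 := norm_apply_of_image_closedBall (mul_mem (inv_mem hg) hf) (Real.sqrt_pos.2 hħ) h1
  rw [← stateOf_mul_of_norm g h2, mul_inv_cancel_left]

/-! ### The projections -/

/-- The map `g⁻¹ f` lies over the identity operator, so it preserves every Wigner transform. That of
the Gaussian centred at `z` attains its maximum only at `z`, which must therefore be fixed. -/
theorem eq_of_wignerCovariant (hħ : 0 < ħ) {U : UnitaryOp n} {f g : Equiv.Perm (Phase n)}
    (hf : WignerCovariant ħ U f) (hg : WignerCovariant ħ U g) : f = g := by
  have h1 : WignerCovariant ħ (1 : UnitaryOp n) (g⁻¹ * f) := by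
    have := hg.inv.mul hf
    rwa [inv_mul_cancel] at this
  have h2 : ∀ z, (g⁻¹ * f) z = z := fun z => by
    obtain ⟨ψ, hψ⟩ := stateOf_nonempty hħ (translation_mem z)
    have hψ' : ∀ v, wigner ħ ψ v
        = (((1 / (Real.pi * ħ)) ^ n * Real.exp (-(1 / ħ) * ‖v - z‖ ^ 2) : ℝ) : ℂ) := fun v => by
      rw [← hψ (v - z)]
      congr 1
      exact (sub_add_cancel v z).symm
    have h3 := (hψ' ((g⁻¹ * f) z)).symm.trans ((h1 ψ z).trans (hψ' z))
    have hpi := Real.pi_pos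
    have hc : (1 / (Real.pi * ħ)) ^ n ≠ 0 := by positivity
    have h4 := Real.exp_injective (mul_left_cancel₀ hc (Complex.ofReal_injective h3))
    rw [sub_self, norm_zero] at h4
    have h5 : -(1 / ħ) ≠ 0 := by
      have : 0 < 1 / ħ := by positivity
      linarith
    have h6 := mul_left_cancel₀ h5 h4
    rw [zero_pow two_ne_zero, sq_eq_zero_iff, norm_eq_zero, sub_eq_zero] at h6
    exact h6
  have h3 : g⁻¹ * f = 1 := Equiv.ext h2
  exact (inv_mul_eq_one.1 h3).symm

theorem spMap_injective : Function.Injective (spMap n) := fun S S' h => by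
  apply Subtype.ext
  apply Matrix.ext_of_mulVec_single
  intro i
  have h1 := congrArg (fun f : Equiv.Perm (Phase n) => (f (WithLp.toLp 2 (Pi.single i 1))).ofLp) h
  exact h1

theorem exists_wignerCovariant_Mp (hħ : 0 < ħ) (U : Mp n hħ) :
    ∃ S : Sp n, WignerCovariant ħ (U : UnitaryOp n) (spMap n S) := by
  obtain ⟨U, hU⟩ := U
  change ∃ S : Sp n, WignerCovariant ħ U (spMap n S)
  induction hU using Subgroup.closure_induction with
  | mem U hU =>
    rcases hU with (rfl | ⟨P, hP, rfl⟩) | ⟨L, m, -, rfl⟩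
    · exact ⟨_, wignerCovariant_opJ hħ⟩
    · exact ⟨_, wignerCovariant_opV ħ hP⟩
    · exact ⟨_, wignerCovariant_opM ħ L m⟩
  | one => exact ⟨1, by rw [map_one]; exact WignerCovariant.one ħ⟩
  | mul U V _ _ hU hV =>
    obtain ⟨S, hS⟩ := hU
    obtain ⟨S', hS'⟩ := hV
    exact ⟨S * S', by rw [map_mul]; exact hS.mul hS'⟩
  | inv U _ hU =>
    obtain ⟨S, hS⟩ := hU
    exact ⟨S⁻¹, by rw [map_inv]; exact hS.inv⟩

theorem exists_wignerCovariant_IMp (hħ : 0 < ħ) (U : IMp n hħ) :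
    ∃ f : ISp n, WignerCovariant ħ (U : UnitaryOp n) f := by
  obtain ⟨U, hU⟩ := U
  change ∃ f : ISp n, WignerCovariant ħ U f
  induction hU using Subgroup.closure_induction with
  | mem U hU =>
    rcases hU with hU | ⟨z₀, rfl⟩
    · obtain ⟨S, hS⟩ := exists_wignerCovariant_Mp hħ ⟨U, hU⟩
      exact ⟨⟨_, spMap_mem S⟩, hS⟩
    · exact ⟨⟨_, translation_mem z₀⟩, wignerCovariant_heisenberg ħ z₀⟩
  | one => exact ⟨1, WignerCovariant.one ħ⟩
  | mul U V _ _ hU hV =>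
    obtain ⟨f, hf⟩ := hU
    obtain ⟨g, hg⟩ := hV
    exact ⟨f * g, hf.mul hg⟩
  | inv U _ hU =>
    obtain ⟨f, hf⟩ := hU
    exact ⟨f⁻¹, hf.inv⟩

/-- The natural projection `Mp(n) → Sp(n)`. -/
noncomputable def projMp (hħ : 0 < ħ) : Mp n hħ →* Sp n :=
  -- The chosen matrix is the only possible one, and the product of two choices lies over the
  -- product operator; hence multiplicativity.
  MonoidHom.mk' (fun U => (exists_wignerCovariant_Mp hħ U).choose) fun U V =>
    spMap_injective <| by
      rw [map_mul]
      exact eq_of_wignerCovariant hħ (exists_wignerCovariant_Mp hħ (U * V)).choose_spec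
        ((exists_wignerCovariant_Mp hħ U).choose_spec.mul
          (exists_wignerCovariant_Mp hħ V).choose_spec)

/-- The natural projection `IMp(n) → ISp(n)`. -/
noncomputable def projIMp (hħ : 0 < ħ) : IMp n hħ →* ISp n :=
  MonoidHom.mk' (fun U => (exists_wignerCovariant_IMp hħ U).choose) fun U V =>
    Subtype.ext <| eq_of_wignerCovariant hħ (exists_wignerCovariant_IMp hħ (U * V)).choose_spec
      ((exists_wignerCovariant_IMp hħ U).choose_spec.mul
        (exists_wignerCovariant_IMp hħ V).choose_spec)

theorem wignerCovariant_projMp (hħ : 0 < ħ) (U : Mp n hħ) :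
    WignerCovariant ħ (U : UnitaryOp n) (spMap n (projMp hħ U)) :=
  (exists_wignerCovariant_Mp hħ U).choose_spec

theorem wignerCovariant_projIMp (hħ : 0 < ħ) (U : IMp n hħ) :
    WignerCovariant ħ (U : UnitaryOp n) (projIMp hħ U : Equiv.Perm (Phase n)) :=
  (exists_wignerCovariant_IMp hħ U).choose_spec

theorem projMp_eq (hħ : 0 < ħ) {U : Mp n hħ} {S : Sp n}
    (h : WignerCovariant ħ (U : UnitaryOp n) (spMap n S)) : projMp hħ U = S :=
  spMap_injective (eq_of_wignerCovariant hħ (wignerCovariant_projMp hħ U) h)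

theorem projMp_opJ (n : ℕ) (hħ : 0 < ħ) :
    projMp hħ ⟨opJ n hħ, opJ_mem n hħ⟩ = ⟨_, quarterTurn_mem⟩ :=
  projMp_eq hħ (U := ⟨opJ n hħ, opJ_mem n hħ⟩) (wignerCovariant_opJ hħ)

theorem projMp_opV (hħ : 0 < ħ) {P : Matrix (Fin n) (Fin n) ℝ} (hP : P.IsSymm) :
    projMp hħ ⟨opV ħ P, opV_mem hħ hP⟩ = ⟨_, lowerShear_mem hP.neg⟩ :=
  projMp_eq hħ (U := ⟨opV ħ P, opV_mem hħ hP⟩) (wignerCovariant_opV ħ hP)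

theorem projMp_opM (hħ : 0 < ħ) {L : GL (Fin n) ℝ} {m : ℤ}
    (hm : (-1 : ℝ) ^ m * |(L : Matrix (Fin n) (Fin n) ℝ).det|
      = (L : Matrix (Fin n) (Fin n) ℝ).det) :
    projMp hħ ⟨opM L m, opM_mem hħ hm⟩ = ⟨_, diagonal_mem L⟩ :=
  projMp_eq hħ (U := ⟨opM L m, opM_mem hħ hm⟩) (wignerCovariant_opM ħ L m)

theorem projIMp_mul_heisenberg (hħ : 0 < ħ) (U : Mp n hħ) (z₀ : Phase n) :
    projIMp hħ ⟨(U : UnitaryOp n) * heisenberg ħ z₀, Mp_mul_heisenberg_mem hħ U z₀⟩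
      = ⟨spMap n (projMp hħ U) * translation z₀, spMap_mul_translation_mem (projMp hħ U) z₀⟩ :=
  Subtype.ext (eq_of_wignerCovariant hħ (wignerCovariant_projIMp hħ _)
    ((wignerCovariant_projMp hħ U).mul (wignerCovariant_heisenberg ħ z₀)))

theorem projMp_surjective (hħ : 0 < ħ) : Function.Surjective (projMp (n := n) hħ) := by
  rw [← MonoidHom.range_eq_top]
  refine subgroup_eq_top ⟨⟨_, opJ_mem n hħ⟩, projMp_opJ n hħ⟩ ?_ ?_
  · intro P hP
    -- The sign is reversed because `V̂_P` lies over the shear with block `-P`.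
    refine ⟨⟨_, opV_mem hħ hP.neg⟩, (projMp_opV hħ hP.neg).trans ?_⟩
    simp only [neg_neg]
  · intro L
    obtain ⟨m, hm⟩ : ∃ m : ℤ, (-1 : ℝ) ^ m * |(L : Matrix (Fin n) (Fin n) ℝ).det|
        = (L : Matrix (Fin n) (Fin n) ℝ).det := by
      rcases le_total 0 (L : Matrix (Fin n) (Fin n) ℝ).det with h | h
      · exact ⟨0, by rw [zpow_zero, one_mul, abs_of_nonneg h]⟩
      · exact ⟨1, by rw [zpow_one, abs_of_nonpos h, neg_one_mul, neg_neg]⟩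
    exact ⟨⟨_, opM_mem hħ hm⟩, projMp_opM hħ hm⟩

theorem projIMp_surjective (hħ : 0 < ħ) : Function.Surjective (projIMp (n := n) hħ) := by
  rintro ⟨_, S, z₀, rfl⟩
  obtain ⟨U, rfl⟩ := projMp_surjective hħ S
  exact ⟨_, projIMp_mul_heisenberg hħ U z₀⟩

/-! ### The ellipsoid of a Gaussian state -/

/-- `Sᵀ (S Sᵀ)⁻¹ S = 1`, so `S_{AB}` carries the Euclidean form to that of `G_{AB}`. -/
theorem quad_matG {A B : Matrix (Fin n) (Fin n) ℝ} (hA : A.PosDef) (hB : B.IsSymm)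
    (z : Phase n) : quad (matG A B) (lin (matS A B) z) = ‖z‖ ^ 2 := by
  have hu := SymplecticGroup.symplectic_det (matS_mem hA hB)
  have hu' : IsUnit (matS A B)ᵀ.det := by rwa [Matrix.det_transpose]
  rw [quad_lin, matG, Matrix.mul_inv_rev, Matrix.mul_nonsing_inv_cancel_left _ _ hu',
    Matrix.nonsing_inv_mul _ hu, quad_one]

theorem quad_matG_eq {A B : Matrix (Fin n) (Fin n) ℝ} (hA : A.PosDef) (hB : B.IsSymm)
    (z₀ z : Phase n) : quad (matG A B) (z - z₀)
      = ‖(translation z₀ * spMap n ⟨matS A B, matS_mem hA hB⟩).symm z‖ ^ 2 := by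
  rw [← quad_matG hA hB]
  congr 1
  rw [sub_eq_iff_eq_add]
  exact ((translation z₀ * spMap n ⟨matS A B, matS_mem hA hB⟩).apply_symm_apply z).symm

theorem image_closedBall_eq_ellipsoid {A B : Matrix (Fin n) (Fin n) ℝ} (hħ : 0 < ħ)
    (hA : A.PosDef) (hB : B.IsSymm) (z₀ : Phase n) :
    (translation z₀ * spMap n ⟨matS A B, matS_mem hA hB⟩) '' Metric.closedBall 0 √ħ
      = {z | quad (matG A B) (z - z₀) ≤ ħ} := by
  ext z
  rw [Equiv.image_eq_preimage_symm, Set.mem_preimage, mem_closedBall_zero_iff,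
    Set.mem_ofPred_eq, quad_matG_eq hA hB, Real.le_sqrt (norm_nonneg _) hħ.le]

theorem mem_gaussState_iff {A B : Matrix (Fin n) (Fin n) ℝ} (hħ : 0 < ħ)
    (hA : A.PosDef) (hB : B.IsSymm) (z₀ : Phase n) (ψ : L2 n) :
    ψ ∈ gaussState ħ z₀ A B ↔ ∀ z : Phase n, wigner ħ ψ z = (((1 / (Real.pi * ħ)) ^ n
      * Real.exp (-(1 / ħ) * quad (matG A B) (z - z₀)) : ℝ) : ℂ) := by
  rw [gaussState_eq_stateOf hħ z₀ hA hB]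
  simp_rw [quad_matG_eq hA hB]
  constructor
  · intro h z
    rw [← h, Equiv.apply_symm_apply]
  · intro h z
    rw [h, Equiv.symm_apply_apply]

/-! ### The bijections -/

/-- Both sets are parametrized by `f` in `ISp(n)`, as `stateOf ħ f` and as `f(B(√ħ))`, and `blob`
matches the two parametrizations. -/
theorem bijOn_blob_Gauss (hħ : 0 < ħ) : Set.BijOn (blob ħ) (Gauss n ħ) (QB n ħ) := by
  refine ⟨fun s hs => ?_, fun s hs s' hs' h => ?_, fun Q hQ => ?_⟩
  · obtain ⟨f, hf, rfl⟩ := (mem_Gauss_iff hħ).1 hs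
    exact mem_QB_iff.2 ⟨f, hf, blob_stateOf hħ hf⟩
  · obtain ⟨f, hf, rfl⟩ := (mem_Gauss_iff hħ).1 hs
    obtain ⟨g, hg, rfl⟩ := (mem_Gauss_iff hħ).1 hs'
    rw [blob_stateOf hħ hf, blob_stateOf hħ hg] at h
    exact stateOf_eq_of_image_closedBall_eq hħ hf hg h
  · obtain ⟨f, hf, rfl⟩ := mem_QB_iff.1 hQ
    exact ⟨_, (mem_Gauss_iff hħ).2 ⟨f, hf, rfl⟩, blob_stateOf hħ hf⟩

theorem Gauss₀_subset_Gauss (hħ : 0 < ħ) : Gauss₀ n ħ ⊆ Gauss n ħ := fun s hs => by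
  obtain ⟨S, rfl⟩ := (mem_Gauss₀_iff hħ).1 hs
  exact (mem_Gauss_iff hħ).2 ⟨_, spMap_mem S, rfl⟩

theorem bijOn_blob_Gauss₀ (hħ : 0 < ħ) : Set.BijOn (blob ħ) (Gauss₀ n ħ) (QB₀ n ħ) := by
  refine ⟨fun s hs => ?_, (bijOn_blob_Gauss hħ).injOn.mono (Gauss₀_subset_Gauss hħ),
    fun Q hQ => ?_⟩
  · obtain ⟨S, rfl⟩ := (mem_Gauss₀_iff hħ).1 hs
    exact ⟨S, blob_stateOf hħ (spMap_mem S)⟩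
  · obtain ⟨S, rfl⟩ := hQ
    exact ⟨_, (mem_Gauss₀_iff hħ).2 ⟨S, rfl⟩, blob_stateOf hħ (spMap_mem S)⟩

end QuantumBlob

theorem mainTheorem3 (n : ℕ) (ħ : ℝ) (hħ : 0 < ħ) :
    ∃ (Φ : Set (L2 n) → Set (Phase n)) (pr : Mp n hħ →* Sp n) (prI : IMp n hħ →* ISp n),
      -- the correspondence `Gauss(n) ↔ QB(n)` and the Wigner transform
      Set.BijOn Φ (Gauss n ħ) (QB n ħ) ∧
      Set.BijOn Φ (Gauss₀ n ħ) (QB₀ n ħ) ∧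
      (∀ (z₀ : Phase n) (A B : Matrix (Fin n) (Fin n) ℝ), A.PosDef → B.IsSymm →
        matS A B ∈ Sp n ∧
        Φ (gaussState ħ z₀ A B)
          = translation z₀ '' (lin (matS A B) '' Metric.closedBall 0 √ħ) ∧
        Φ (gaussState ħ z₀ A B) = {z | quad (matG A B) (z - z₀) ≤ ħ} ∧
        ∀ ψ : L2 n, ψ ∈ gaussState ħ z₀ A B ↔
          ∀ z : Phase n, wigner ħ ψ z = (((1 / (Real.pi * ħ)) ^ n
            * Real.exp (-(1 / ħ) * quad (matG A B) (z - z₀)) : ℝ) : ℂ)) ∧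
      -- the projections `Mp(n) → Sp(n)` and `IMp(n) → ISp(n)`
      ((pr ⟨opJ n hħ, opJ_mem n hħ⟩ : Matrix (Fin n ⊕ Fin n) (Fin n ⊕ Fin n) ℝ)
        = Matrix.fromBlocks 0 1 (-1) 0) ∧
      (∀ (P : Matrix (Fin n) (Fin n) ℝ) (hP : P.IsSymm),
        (pr ⟨opV ħ P, opV_mem hħ hP⟩ : Matrix (Fin n ⊕ Fin n) (Fin n ⊕ Fin n) ℝ)
          = Matrix.fromBlocks 1 0 (-P) 1) ∧
      (∀ (L : GL (Fin n) ℝ) (m : ℤ)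
        (hm : (-1 : ℝ) ^ m * |(L : Matrix (Fin n) (Fin n) ℝ).det|
          = (L : Matrix (Fin n) (Fin n) ℝ).det),
        (pr ⟨opM L m, opM_mem hħ hm⟩ : Matrix (Fin n ⊕ Fin n) (Fin n ⊕ Fin n) ℝ)
          = Matrix.fromBlocks (L : Matrix (Fin n) (Fin n) ℝ)⁻¹ 0 0
            (L : Matrix (Fin n) (Fin n) ℝ)ᵀ) ∧
      Function.Surjective pr ∧
      (∀ (U : Mp n hħ) (z₀ : Phase n),
        prI ⟨(U : UnitaryOp n) * heisenberg ħ z₀, Mp_mul_heisenberg_mem hħ U z₀⟩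
          = ⟨spMap n (pr U) * translation z₀, spMap_mul_translation_mem (pr U) z₀⟩) ∧
      Function.Surjective prI ∧
      -- the transitive action of `Sp(n)` on `QB₀(n)`
      (∀ S : Sp n, ∀ Q ∈ QB₀ n ħ, spMap n S '' Q ∈ QB₀ n ħ) ∧
      (∀ Q ∈ QB₀ n ħ, ∀ Q' ∈ QB₀ n ħ, ∃ S : Sp n, spMap n S '' Q = Q') ∧
      -- the induced transitive action of `Mp(n)` on `Gauss₀(n)`
      (∀ U : Mp n hħ, ∀ s ∈ Gauss₀ n ħ,
        (U : UnitaryOp n) '' s ∈ Gauss₀ n ħ ∧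
        Φ ((U : UnitaryOp n) '' s) = spMap n (pr U) '' Φ s) ∧
      (∀ s ∈ Gauss₀ n ħ, ∀ s' ∈ Gauss₀ n ħ, ∃ U : Mp n hħ, (U : UnitaryOp n) '' s = s') ∧
      -- the transitive action of `ISp(n)` on `QB(n)`
      (∀ f : ISp n, ∀ Q ∈ QB n ħ, (f : Equiv.Perm (Phase n)) '' Q ∈ QB n ħ) ∧
      (∀ Q ∈ QB n ħ, ∀ Q' ∈ QB n ħ, ∃ f : ISp n, (f : Equiv.Perm (Phase n)) '' Q = Q') ∧
      -- the induced transitive action of `IMp(n)` on `Gauss(n)`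
      (∀ U : IMp n hħ, ∀ s ∈ Gauss n ħ,
        (U : UnitaryOp n) '' s ∈ Gauss n ħ ∧
        Φ ((U : UnitaryOp n) '' s) = (prI U : Equiv.Perm (Phase n)) '' Φ s) ∧
      (∀ s ∈ Gauss n ħ, ∀ s' ∈ Gauss n ħ, ∃ (U : Mp n hħ) (z₀ : Phase n),
        ((U : UnitaryOp n) * heisenberg ħ z₀) '' s = s') := by
  refine ⟨blob ħ, projMp hħ, projIMp hħ, bijOn_blob_Gauss hħ, bijOn_blob_Gauss₀ hħ, ?_,
    by rw [projMp_opJ], fun P hP => by rw [projMp_opV hħ hP], fun L m hm => by rw [projMp_opM hħ hm],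
    projMp_surjective hħ, projIMp_mul_heisenberg hħ, projIMp_surjective hħ,
    ?_, ?_, ?_, ?_, ?_, ?_, ?_, ?_⟩
  · intro z₀ A B hA hB
    have h : blob ħ (gaussState ħ z₀ A B)
        = (translation z₀ * spMap n ⟨matS A B, matS_mem hA hB⟩) '' Metric.closedBall 0 √ħ := by
      rw [gaussState_eq_stateOf hħ z₀ hA hB,
        blob_stateOf hħ (mul_mem (translation_mem z₀) (spMap_mem _))]
    refine ⟨matS_mem hA hB, h.trans (Set.image_comp (translation z₀) (lin (matS A B)) _),
      h.trans (image_closedBall_eq_ellipsoid hħ hA hB z₀), mem_gaussState_iff hħ hA hB z₀⟩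
  · rintro S _ ⟨S', rfl⟩
    exact ⟨S * S', by rw [map_mul, Equiv.Perm.coe_mul, Set.image_comp]⟩
  · rintro _ ⟨S, rfl⟩ _ ⟨S', rfl⟩
    refine ⟨S' * S⁻¹, ?_⟩
    rw [← Set.image_comp, ← Equiv.Perm.coe_mul, ← map_mul, inv_mul_cancel_right]
  · intro U s hs
    refine ⟨?_, (wignerCovariant_projMp hħ U).blob_image s⟩
    obtain ⟨S, rfl⟩ := (mem_Gauss₀_iff hħ).1 hs
    rw [(wignerCovariant_projMp hħ U).image_stateOf, ← map_mul]
    exact (mem_Gauss₀_iff hħ).2 ⟨_, rfl⟩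
  · intro s hs s' hs'
    obtain ⟨S, rfl⟩ := (mem_Gauss₀_iff hħ).1 hs
    obtain ⟨S', rfl⟩ := (mem_Gauss₀_iff hħ).1 hs'
    obtain ⟨U, hU⟩ := projMp_surjective hħ (S' * S⁻¹)
    refine ⟨U, ?_⟩
    rw [(wignerCovariant_projMp hħ U).image_stateOf, ← map_mul, hU, inv_mul_cancel_right]
  · intro f Q hQ
    obtain ⟨g, hg, rfl⟩ := mem_QB_iff.1 hQ
    exact mem_QB_iff.2 ⟨f * g, mul_mem f.2 hg, by rw [Equiv.Perm.coe_mul, Set.image_comp]⟩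
  · intro Q hQ Q' hQ'
    obtain ⟨g, hg, rfl⟩ := mem_QB_iff.1 hQ
    obtain ⟨g', hg', rfl⟩ := mem_QB_iff.1 hQ'
    refine ⟨⟨g' * g⁻¹, mul_mem hg' (inv_mem hg)⟩, ?_⟩
    rw [← Set.image_comp, ← Equiv.Perm.coe_mul, inv_mul_cancel_right]
  · intro U s hs
    refine ⟨?_, (wignerCovariant_projIMp hħ U).blob_image s⟩
    obtain ⟨f, hf, rfl⟩ := (mem_Gauss_iff hħ).1 hs
    rw [(wignerCovariant_projIMp hħ U).image_stateOf]
    exact (mem_Gauss_iff hħ).2 ⟨_, mul_mem (projIMp hħ U).2 hf, rfl⟩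
  · intro s hs s' hs'
    obtain ⟨f, hf, rfl⟩ := (mem_Gauss_iff hħ).1 hs
    obtain ⟨f', hf', rfl⟩ := (mem_Gauss_iff hħ).1 hs'
    -- The map `f' f⁻¹` is itself of the form `S T(z₀)`, and any lift of `S` gives the required
    -- operator.
    obtain ⟨S, z₀, h⟩ := mul_mem hf' (inv_mem hf)
    obtain ⟨U, rfl⟩ := projMp_surjective hħ S
    refine ⟨U, z₀, ?_⟩
    rw [((wignerCovariant_projMp hħ U).mul (wignerCovariant_heisenberg ħ z₀)).image_stateOf, ← h,
      inv_mul_cancel_right]
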